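/- Let $k_0,b_0>0$ and, for $N\ge1$, put $\rho_0=N/(2\pi)$, $a_0^2=k_0/\rho_0^2$. For $\varepsilon\ge0$ and profiles $k^{(f,purt)},k^{(b,purt)}$ on $[0,2\pi]$ let $k_s=k^{(f,purt)}+k^{(b,purt)}$, $k_m=k^{(f,purt)}-k^{(b,purt)}$ and consider the mistuned PDE $$v_{tt}+b_0v_t=a_0^2v_{xx}+\varepsilon\Big[\frac{k_m}{\rho_0}v_x+\frac{k_s}{2\rho_0^2}v_{xx}\Big],\qquad v(0,t)=v(2\pi,t)=0 .$$ An eigenvalue is a number $s\in\mathbb C$ for which $v(x,t)=e^{st}\eta(x)$ solves the PDE for some nonzero complex-valued $\eta\in H^2(0,2\pi)$ with $\eta(0)=\eta(2\pi)=0$. Take $k^{(b,purt)}=-k^{(f,purt)}$, write $\kappa=k^{(f,purt)}$, and call $\kappa$ admissible if $\kappa\in L^\infty([0,2\pi])$ is real-valued and $\|\kappa\|_{L^\infty}=\max\kappa=1$ (essential maximum). Let $s_1^+(\varepsilon,N,\kappa)$ be the supremum of the real parts of the eigenvalues. Let $\kappa^*(x)=2\big(H(x-\pi)-\tfrac12\big)$,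 where $H(x)=1$ for $x\ge0$ and $H(x)=0$ for $x<0$. Then $\kappa^*$ is admissible, and there are $N_0\ge1$, $\varepsilon_0>0$, $C$, depending only on $k_0,b_0$, and numbers $r(N,\kappa)$ such that for all $N\ge N_0$, $0\le\varepsilon<\varepsilon_0$ and all admissible $\kappa$: 1. (Least stable eigenvalue) $s_1^+(\varepsilon,N,\kappa)$ is itself an eigenvalue, and every other eigenvalue has strictly smaller real part. 2. (First-order expansion) $|s_1^+(\varepsilon,N,\kappa)-s_1^+(0,N,\kappa)-\varepsilon\,r(N,\kappa)|\le C\varepsilon^2$. 3. (Optimal profile as $\varepsilon\to0$) $r(N,\kappa^*)\le r(N,\kappa)$, with equality if and only if $\kappa=\kappa^*$ almost everywhere; and $s_1^+(\varepsilon,N,\kappa^*)\le s_1^+(\varepsilon,N,\kappa)+C\varepsilon^2$. 4. (Asymptotic formula for $\kappa^*$) $\big|r(N,\kappa^*)+\frac{4}{b_0N}\big|\le\frac{C}{N^2}$ and $\big|s_1^+(\varepsilon,N,\kappa^*)+\frac{4\varepsilon}{b_0N}\big|\le C\big(\varepsilon^2+\frac1{N^2}\big)$. 5. (Order $1/N$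 instead of $1/N^2$) $s_1^+(\varepsilon,N,\kappa^*)\le-\frac{4\varepsilon}{b_0N}$, whereas without mistuning $\big|s_1^+(0,N,\kappa)+\frac{\pi^2k_0}{b_0N^2}\big|\le\frac{C}{N^4}$. -/

import Mathlib

open MeasureTheory

noncomputable section

namespace Platoon

/-- The spatial domain `[0, 2π]`. -/
def dom : Set ℝ := Set.Icc 0 (2 * Real.pi)

/-- Lebesgue measure on `[0, 2π]`. -/
def domMeasure : Measure ℝ := volume.restrict dom

/-- Mean density `ρ₀ = N / (2π)` of a platoon of `N` vehicles. -/
def rho (N : ℕ) : ℝ := N / (2 * Real.pi)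

/-- `η` belongs to the Sobolev space `H²(0, 2π)` (complex-valued), with first derivative `η₁` and
weak second derivative `η₂`: `η` is `C¹` on `[0, 2π]` and its derivative `η₁` is the primitive of
the square-integrable function `η₂`. -/
structure IsH2 (η η₁ η₂ : ℝ → ℂ) : Prop where
  hasDeriv : ∀ x ∈ dom, HasDerivWithinAt η (η₁ x) dom x
  memLp : MemLp η₂ 2 domMeasure
  primitive : ∀ x ∈ dom, η₁ x = η₁ 0 + ∫ t in (0 : ℝ)..x, η₂ t

/-- The eigenvalues, with Dirichlet conditions at both ends, of the mistuned PDE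
`v_tt + b₀ v_t = a₀² v_xx + ε [ (k_m / ρ₀) v_x + (k_s / (2 ρ₀²)) v_xx ]` on `[0, 2π]`, where
`a₀² = k₀ / ρ₀²`, `k_s = kf + kb` and `k_m = kf - kb`: the complex numbers `s` such that
`v(x, t) = exp (s t) η(x)` is a solution for some nonzero `η` in `H²` with `η(0) = η(2π) = 0`. -/
def eigenvalues (k₀ b₀ : ℝ) (N : ℕ) (ε : ℝ) (kf kb : ℝ → ℝ) : Set ℂ :=
  {s | ∃ η η₁ η₂ : ℝ → ℂ, IsH2 η η₁ η₂ ∧ η 0 = 0 ∧ η (2 * Real.pi) = 0 ∧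
    (∃ x ∈ dom, η x ≠ 0) ∧
    ∀ᵐ x ∂domMeasure,
      (s ^ 2 + b₀ * s) * η x =
        ((k₀ / rho N ^ 2 : ℝ) : ℂ) * η₂ x
          + ε * ((((kf x - kb x) / rho N : ℝ) : ℂ) * η₁ x
            + (((kf x + kb x) / (2 * rho N ^ 2) : ℝ) : ℂ) * η₂ x)}

/-- `s` is the (unique) least stable element of a set of eigenvalues: its real part is strictly
larger than that of any other. -/
def IsLeastStable (S : Set ℂ) (s : ℂ) : Prop :=
  s ∈ S ∧ ∀ z ∈ S, z ≠ s → z.re < s.re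

/-- The least stable eigenvalue `s₁⁺(ε)` for the perturbation profiles `kf = κ`, `kb = -κ`,
as the supremum of the real parts of the eigenvalues. (In the regime of the theorem this
supremum is itself a real eigenvalue, which the theorem asserts.) -/
def sOne (k₀ b₀ : ℝ) (N : ℕ) (ε : ℝ) (κ : ℝ → ℝ) : ℝ :=
  sSup (Complex.re '' eigenvalues k₀ b₀ N ε κ (fun x => -κ x))

/-- Admissible profiles: `κ ∈ L^∞([0, 2π])` with `‖κ‖_{L^∞} = max κ = 1`, the maximum of an
element of `L^∞` being its essential supremum. -/
structure Admissible (κ : ℝ → ℝ) : Prop where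
  memLp : MemLp κ ⊤ domMeasure
  norm_eq : eLpNorm κ ⊤ domMeasure = 1
  max_eq : essSup κ domMeasure = 1

/-- The Heaviside function, with `H(0) = 1`. -/
def heaviside (x : ℝ) : ℝ := if 0 ≤ x then 1 else 0

/-- The bang-bang profile `2 (H(x - π) - 1/2)`. -/
def bangBang (x : ℝ) : ℝ := 2 * (heaviside (x - Real.pi) - 1 / 2)

end Platoon

end

open Set Filter Topology

namespace Platoon

/-! With `kb = -kf` the second-order perturbation cancels. Division by a₀² = k₀/ρ₀² leaves η'' +
cκη' = -μη, where c = εN/(πk₀) and s² + b₀s = -a₀²μ. The weight p = exp(c∫κ) makes this the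
Sturm–Liouville problem (pη')' = -μpη. Complex Dirichlet eigenvalues μ are therefore real, and the
least of them is the principal one μ₁, whose eigenfunction is positive. The root of s² + b₀s + a₀²μ₁
= 0 with the larger real part is the least stable eigenvalue. It is real because a₀²μ₁ < b₀²/4 for N
large and ε small.

The crux is |μ₁ - 1/4 - c·m(κ)| ≤ 9c² for every c, where m(κ) = -(1/4π)∫κ sin. Small c would not
suffice, since c grows with N. But a₀²c² = 4ε²/k₀ does not involve N, so a quadratic error valid for
all c becomes an O(ε²) error uniform in N. The bound is a Barta-type comparison. The trial function
φ = sin(x/2)·exp(c∫g) has quotient -(pφ')'/(pφ) = 1/4 + cm - c²(g² + κg) when g is chosen to absorb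
the first-order term. The value of m is exactly the one that keeps g bounded at both end points. The
Wronskian of φ with a positive solution is then monotone, which traps μ₁ (`le_of_slPair_of_nonneg`,
`ge_of_slPair`). Existence of μ₁ comes from shooting with the Prüfer angle
(`exists_principal_slPair`), and its minimality among complex eigenvalues from a Picone identity
(`real_and_ge_of_slPairC`).

Since κ* = -sgn(sin) almost everywhere on the domain, it alone maximizes m among profiles bounded by
1, and m(κ*) = 1/π. Expanding the quadratic root gives r(N,κ) = -(4π/N)·m(κ)/√(b₀² - a₀²). The bound
s ≤ -4ε/(b₀N) has no error term and needs a separate argument: on each half interval κ* is constant,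
an explicit comparison gives μ₁ ≥ 1/4 + c²/4 ≥ c/2 ≥ c/π, and a₀²c/π = 4ε/N. -/

/-- A real solution of `(p u')' = -μ p u` on `[0, L]`, as a first-order system with `v = p u'`. -/
structure SLPair (p : ℝ → ℝ) (L μ : ℝ) (u v : ℝ → ℝ) : Prop where
  hasDeriv_fst : ∀ x ∈ Icc 0 L, HasDerivWithinAt u (v x / p x) (Icc 0 L) x
  hasDeriv_snd : ∀ x ∈ Icc 0 L, HasDerivWithinAt v (-(μ * p x * u x)) (Icc 0 L) x

/-! ### Prüfer angle and existence of the principal eigenvalue -/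

/-- The vector field of the Prüfer angle. -/
noncomputable def pruferField (p : ℝ → ℝ) (μ t θ : ℝ) : ℝ :=
  Real.cos θ ^ 2 / p t + μ * p t * Real.sin θ ^ 2

lemma abs_sin_sq_sub_le (a b : ℝ) : |Real.sin a ^ 2 - Real.sin b ^ 2| ≤ 2 * |a - b| := by
  have h1 : |Real.sin a - Real.sin b| ≤ |a - b| := by
    have := Real.lipschitzWith_sin.dist_le_mul a b
    simpa [Real.dist_eq] using this
  have h2 : |Real.sin a + Real.sin b| ≤ 2 := by
    rw [abs_le]
    constructor <;> linarith [Real.neg_one_le_sin a, Real.neg_one_le_sin b, Real.sin_le_one a,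
      Real.sin_le_one b]
  have h3 : Real.sin a ^ 2 - Real.sin b ^ 2
      = (Real.sin a + Real.sin b) * (Real.sin a - Real.sin b) := by ring
  rw [h3, abs_mul]
  exact mul_le_mul h2 h1 (abs_nonneg _) (by norm_num)

lemma pruferField_lipschitz {p : ℝ → ℝ} {B M t μ : ℝ} (hp : 0 < p t) (hpB : p t ≤ B)
    (hpB' : (p t)⁻¹ ≤ B) (hμ : 0 ≤ μ) (hμM : μ ≤ M) :
    LipschitzWith (Real.toNNReal (2 * (M * B + B))) (pruferField p μ t) := by
  have hB : 0 ≤ B := hp.le.trans hpB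
  have hM : 0 ≤ M := hμ.trans hμM
  refine LipschitzWith.of_dist_le_mul fun a b => ?_
  rw [Real.coe_toNNReal _ (by positivity), Real.dist_eq, Real.dist_eq]
  have h1 : pruferField p μ t a - pruferField p μ t b
      = (μ * p t - (p t)⁻¹) * (Real.sin a ^ 2 - Real.sin b ^ 2) := by
    simp only [pruferField, Real.cos_sq']
    field_simp
    ring
  have h2 : |μ * p t - (p t)⁻¹| ≤ M * B + B := by
    have : μ * p t ≤ M * B := mul_le_mul hμM hpB hp.le hM
    have : 0 ≤ μ * p t := by positivity
    have : 0 < (p t)⁻¹ := by positivity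
    rw [abs_le]
    constructor <;> nlinarith
  rw [h1, abs_mul]
  calc _ ≤ (M * B + B) * (2 * |a - b|) :=
        mul_le_mul h2 (abs_sin_sq_sub_le a b) (abs_nonneg _) (by positivity)
    _ = _ := by ring

lemma pruferField_nonneg {p : ℝ → ℝ} {t μ : ℝ} (hp : 0 < p t) (hμ : 0 ≤ μ) (θ : ℝ) :
    0 ≤ pruferField p μ t θ := by
  unfold pruferField
  positivity

lemma pruferField_pos {p : ℝ → ℝ} {t μ : ℝ} (hp : 0 < p t) (hμ : 0 < μ) (θ : ℝ) :
    0 < pruferField p μ t θ := by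
  unfold pruferField
  by_cases h : Real.sin θ = 0
  · have : Real.cos θ ^ 2 = 1 := by rw [Real.cos_sq', h]; norm_num
    rw [this]
    positivity
  · positivity

lemma pruferField_le {p : ℝ → ℝ} {B M t μ : ℝ} (hp : 0 < p t) (hpB : p t ≤ B)
    (hpB' : (p t)⁻¹ ≤ B) (hμ : 0 ≤ μ) (hμM : μ ≤ M) (θ : ℝ) :
    pruferField p μ t θ ≤ M * B + B := by
  have hB : 0 ≤ B := hp.le.trans hpB
  have hM : 0 ≤ M := hμ.trans hμM
  unfold pruferField
  have h1 : Real.cos θ ^ 2 / p t ≤ 1 * B := by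
    rw [div_eq_mul_inv]
    exact mul_le_mul (Real.cos_sq_le_one θ) hpB' (by positivity) (by norm_num)
  have h2 : μ * p t * Real.sin θ ^ 2 ≤ M * B * 1 :=
    mul_le_mul (mul_le_mul hμM hpB hp.le hM) (Real.sin_sq_le_one θ) (by positivity)
      (by positivity)
  linarith

lemma exists_bound_self_inv {p : ℝ → ℝ} (hp : Continuous p) (hpos : ∀ x, 0 < p x) (L : ℝ) :
    ∃ B, 0 < B ∧ ∀ t ∈ Icc 0 L, p t ≤ B ∧ (p t)⁻¹ ≤ B := by
  obtain ⟨B₁, h₁⟩ := isCompact_Icc.exists_bound_of_continuousOn (s := Icc 0 L) hp.continuousOn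
  obtain ⟨B₂, h₂⟩ := isCompact_Icc.exists_bound_of_continuousOn (s := Icc 0 L)
    (hp.inv₀ fun x => (hpos x).ne').continuousOn
  refine ⟨max 1 (max B₁ B₂), by positivity, fun t ht => ⟨?_, ?_⟩⟩
  · exact (le_abs_self _).trans ((h₁ t ht).trans (by simp))
  · exact (le_abs_self _).trans ((h₂ t ht).trans (by simp))

/-- The Prüfer angle exists on the whole interval. -/
lemma exists_pruferAngle {p : ℝ → ℝ} (hp : Continuous p) (hpos : ∀ x, 0 < p x) {L : ℝ}
    (hL : 0 < L) {μ : ℝ} (hμ : 0 ≤ μ) :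
    ∃ θ : ℝ → ℝ, θ 0 = 0 ∧
      ∀ t ∈ Icc 0 L, HasDerivWithinAt θ (pruferField p μ t (θ t)) (Icc 0 L) t := by
  obtain ⟨B, hB, hpB⟩ := exists_bound_self_inv hp hpos L
  -- The field is bounded by μB + B for all angles, so a ball of radius (μB + B)L cannot be left
  -- before time L and the solution is global.
  have key : IsPicardLindelof (pruferField p μ) (⟨0, le_rfl, hL.le⟩ : Icc 0 L) 0
      (Real.toNNReal ((μ * B + B) * L)) 0 (Real.toNNReal (μ * B + B))
      (Real.toNNReal (2 * (μ * B + B))) := by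
    refine ⟨fun t ht => ?_, fun x _ => ?_, fun t ht x _ => ?_, ?_⟩
    · exact (pruferField_lipschitz (hpos t) (hpB t ht).1 (hpB t ht).2 hμ le_rfl).lipschitzOnWith
    · have : Continuous fun t => pruferField p μ t x := by
        unfold pruferField
        exact (continuous_const.div hp fun t => (hpos t).ne').add
          ((continuous_const.mul hp).mul continuous_const)
      exact this.continuousOn
    · rw [Real.norm_of_nonneg (pruferField_nonneg (hpos t) hμ x),
        Real.coe_toNNReal _ (by positivity)]
      exact pruferField_le (hpos t) (hpB t ht).1 (hpB t ht).2 hμ le_rfl x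
    · rw [Real.coe_toNNReal _ (by positivity), Real.coe_toNNReal _ (by positivity)]
      simp [hL.le]
  exact key.exists_eq_forall_mem_Icc_hasDerivWithinAt₀

/-- The Prüfer angle at the right end point depends continuously on the spectral parameter. -/
lemma continuousOn_pruferAngle_right {p : ℝ → ℝ} (hp : Continuous p) (hpos : ∀ x, 0 < p x)
    {L M : ℝ} (hL : 0 < L) (hM : 0 ≤ M) {θ : ℝ → ℝ → ℝ}
    (h0 : ∀ μ ∈ Icc 0 M, θ μ 0 = 0)
    (h : ∀ μ ∈ Icc 0 M, ∀ t ∈ Icc 0 L,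
      HasDerivWithinAt (θ μ) (pruferField p μ t (θ μ t)) (Icc 0 L) t) :
    ContinuousOn (fun μ => θ μ L) (Icc 0 M) := by
  obtain ⟨B, hB, hpB⟩ := exists_bound_self_inv hp hpos L
  set K : ℝ := 2 * (M * B + B) with hK
  have hKpos : 0 < K := by positivity
  have hcoe : ((Real.toNNReal K : NNReal) : ℝ) = K := Real.coe_toNNReal _ hKpos.le
  have hC : 0 ≤ B / K * (Real.exp (K * L) - 1) := by
    have : 1 ≤ Real.exp (K * L) := Real.one_le_exp (by positivity)
    have : 0 ≤ Real.exp (K * L) - 1 := by linarith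
    positivity
  refine LipschitzOnWith.continuousOn
    (K := Real.toNNReal (B / K * (Real.exp (K * L) - 1)))
    (LipschitzOnWith.of_dist_le_mul fun μ hμ ν hν => ?_)
  rw [Real.coe_toNNReal _ hC]
  have hIci : ∀ μ ∈ Icc 0 M, ∀ t ∈ Ico 0 L,
      HasDerivWithinAt (θ μ) (pruferField p μ t (θ μ t)) (Ici t) t := fun μ hμ t ht =>
    (h μ hμ t (Ico_subset_Icc_self ht)).mono_of_mem_nhdsWithin
      (mem_of_superset (Icc_mem_nhdsGE ht.2) (Icc_subset_Icc_left ht.1))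
  have hcont : ∀ μ ∈ Icc 0 M, ContinuousOn (θ μ) (Icc 0 L) := fun μ hμ t ht =>
    (h μ hμ t ht).continuousWithinAt
  -- The trajectory for ν solves the equation for μ up to an error B|μ - ν|, so Grönwall gives a
  -- Lipschitz bound in the parameter.
  have key := dist_le_of_approx_trajectories_ODE_of_mem (v := pruferField p μ)
    (s := fun _ => univ) (K := Real.toNNReal K) (a := 0) (b := L) (f := θ μ) (g := θ ν)
    (f' := fun t => pruferField p μ t (θ μ t)) (g' := fun t => pruferField p ν t (θ ν t))
    (εf := 0) (εg := B * dist μ ν) (δ := 0)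
    (fun t ht => (pruferField_lipschitz (hpos t) (hpB t (Ico_subset_Icc_self ht)).1
      (hpB t (Ico_subset_Icc_self ht)).2 hμ.1 hμ.2).lipschitzOnWith)
    (hcont μ hμ) (hIci μ hμ) (fun t _ => by simp) (fun _ _ => trivial)
    (hcont ν hν) (hIci ν hν) (fun t ht => by
      have h1 : pruferField p ν t (θ ν t) - pruferField p μ t (θ ν t)
          = (ν - μ) * (p t * Real.sin (θ ν t) ^ 2) := by unfold pruferField; ring
      rw [Real.dist_eq, h1, abs_mul, dist_comm μ, Real.dist_eq, mul_comm B]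
      refine mul_le_mul_of_nonneg_left ?_ (abs_nonneg _)
      rw [abs_of_nonneg (mul_nonneg (hpos t).le (sq_nonneg _))]
      calc _ ≤ B * 1 := mul_le_mul (hpB t (Ico_subset_Icc_self ht)).1 (Real.sin_sq_le_one _)
            (sq_nonneg _) hB.le
        _ = B := mul_one B)
    (fun _ _ => trivial) (by simp [h0 μ hμ, h0 ν hν]) L ⟨hL.le, le_rfl⟩
  rw [hcoe, gronwallBound_of_K_ne_0 hKpos.ne'] at key
  refine key.trans_eq ?_
  simp only [zero_mul, zero_add, sub_zero]
  ring

/-- From the Prüfer angle to a solution. -/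
lemma exists_slPair_of_pruferAngle {p : ℝ → ℝ} (hp : Continuous p) (hpos : ∀ x, 0 < p x) {L : ℝ}
    {μ : ℝ} {θ : ℝ → ℝ}
    (h : ∀ t ∈ Icc 0 L, HasDerivWithinAt θ (pruferField p μ t (θ t)) (Icc 0 L) t) :
    ∃ R : ℝ → ℝ, (∀ x, 0 < R x) ∧
      SLPair p L μ (fun x => R x * Real.sin (θ x)) (fun x => R x * Real.cos (θ x)) := by
  -- With u = R sin θ and v = R cos θ, the system forces (log R)' = (1/p - μp) sin θ cos θ; R is
  -- defined by integrating this.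
  have hθ : ContinuousOn θ (Icc 0 L) := fun t ht => (h t ht).continuousWithinAt
  set f : ℝ → ℝ := fun t => ((p t)⁻¹ - μ * p t) * (Real.sin (θ t) * Real.cos (θ t)) with hf
  have hfc : ContinuousOn f (Icc 0 L) :=
    (((hp.inv₀ fun x => (hpos x).ne').sub (continuous_const.mul hp)).continuousOn).mul
      ((Real.continuous_sin.comp_continuousOn hθ).mul (Real.continuous_cos.comp_continuousOn hθ))
  set R : ℝ → ℝ := fun x => Real.exp (∫ t in (0 : ℝ)..x, f t) with hR
  have hRd : ∀ x ∈ Icc 0 L, HasDerivWithinAt R (R x * f x) (Icc 0 L) x := by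
    intro x hx
    have hint : IntervalIntegrable f volume 0 x :=
      (hfc.mono (by rw [uIcc_of_le hx.1]; exact Icc_subset_Icc_right hx.2)).intervalIntegrable
    have : Fact (x ∈ Icc 0 L) := ⟨hx⟩
    have h1 : HasDerivWithinAt (fun x => ∫ t in (0 : ℝ)..x, f t) (f x) (Icc 0 L) x :=
      intervalIntegral.integral_hasDerivWithinAt_right hint
        (hfc.stronglyMeasurableAtFilter_nhdsWithin measurableSet_Icc x) (hfc x hx)
    exact h1.exp
  refine ⟨R, fun x => Real.exp_pos _, fun x hx => ?_, fun x hx => ?_⟩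
  · convert! (hRd x hx).mul ((h x hx).sin) using 1
    have := (hpos x).ne'
    simp only [hf, pruferField]
    have hs : Real.cos (θ x) ^ 2 = 1 - Real.sin (θ x) ^ 2 := Real.cos_sq' _
    field_simp
    linear_combination (-(R x * Real.cos (θ x))) * hs
  · convert! (hRd x hx).mul ((h x hx).cos) using 1
    have := (hpos x).ne'
    simp only [hf, pruferField]
    have hs : Real.cos (θ x) ^ 2 = 1 - Real.sin (θ x) ^ 2 := Real.cos_sq' _
    field_simp
    linear_combination (μ * p x ^ 2 * R x * Real.sin (θ x)) * hs

/-- Existence of a principal Dirichlet eigenvalue and of a positive eigenfunction, when for some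
spectral parameter no solution stays positive up to the right end point. -/
theorem exists_principal_slPair {p : ℝ → ℝ} (hp : Continuous p) (hpos : ∀ x, 0 < p x) {L M : ℝ}
    (hL : 0 < L) (hM : 0 < M)
    (hhi : ∀ u v, SLPair p L M u v → u 0 = 0 → ¬ ∀ x ∈ Ioc 0 L, 0 < u x) :
    ∃ μ u v, SLPair p L μ u v ∧ u 0 = 0 ∧ u L = 0 ∧ (∀ x ∈ Ioo 0 L, 0 < u x) ∧
      0 < v 0 ∧ v L < 0 := by
  choose! θ hθ0 hθ using fun (μ : ℝ) (hμ : 0 ≤ μ) => exists_pruferAngle hp hpos hL hμ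
  have hcont := continuousOn_pruferAngle_right hp hpos hL hM.le
    (fun μ hμ => hθ0 μ hμ.1) (fun μ hμ => hθ μ hμ.1)
  have hθc : ∀ μ, 0 ≤ μ → ContinuousOn (θ μ) (Icc 0 L) := fun μ hμ t ht =>
    (hθ μ hμ t ht).continuousWithinAt
  have hmono : ∀ μ, 0 < μ → StrictMonoOn (θ μ) (Icc 0 L) := by
    intro μ hμ
    refine strictMonoOn_of_deriv_pos (convex_Icc 0 L) (hθc μ hμ.le) fun x hx => ?_
    rw [interior_Icc] at hx
    rw [((hθ μ hμ.le x (Ioo_subset_Icc_self hx)).hasDerivAt (Icc_mem_nhds hx.1 hx.2)).deriv]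
    exact pruferField_pos (hpos x) hμ _
  -- For μ = 0 the flux R cos θ is a positive constant, so the angle never reaches π/2.
  have hlo : θ 0 L < Real.pi := by
    obtain ⟨R, hR, hS⟩ := exists_slPair_of_pruferAngle hp hpos (hθ 0 le_rfl)
    have hconst : ∀ x ∈ Icc 0 L, R x * Real.cos (θ 0 x) = R 0 * Real.cos (θ 0 0) := by
      refine constant_of_has_deriv_right_zero (fun x hx => (hS.hasDeriv_snd x hx).continuousWithinAt)
        fun x hx => ?_
      have := hS.hasDeriv_snd x (Ico_subset_Icc_self hx)
      simp only [zero_mul, neg_zero] at this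
      exact this.mono_of_mem_nhdsWithin
        (mem_of_superset (Icc_mem_nhdsGE hx.2) (Icc_subset_Icc_left hx.1))
    by_contra! hge
    obtain ⟨x, hx, hxe⟩ := intermediate_value_Icc hL.le (hθc 0 le_rfl)
      (show Real.pi / 2 ∈ Icc (θ 0 0) (θ 0 L) from
        ⟨by rw [hθ0 0 le_rfl]; positivity, by linarith [Real.pi_pos]⟩)
    have := hconst x hx
    rw [hxe, hθ0 0 le_rfl] at this
    simp at this
    exact absurd this (hR 0).ne
  have hhi' : Real.pi ≤ θ M L := by
    by_contra! hlt
    obtain ⟨R, hR, hS⟩ := exists_slPair_of_pruferAngle hp hpos (hθ M hM.le)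
    refine hhi _ _ hS (by simp [hθ0 M hM.le]) fun x hx => mul_pos (hR x) ?_
    have h1 := hmono M hM ⟨le_rfl, hL.le⟩ (Ioc_subset_Icc_self hx) hx.1
    rw [hθ0 M hM.le] at h1
    have h2 := (hmono M hM).monotoneOn (Ioc_subset_Icc_self hx) ⟨hL.le, le_rfl⟩ hx.2
    exact Real.sin_pos_of_pos_of_lt_pi h1 (h2.trans_lt hlt)
  -- The first zero of u after 0 sits at L exactly when the angle ends at π.
  obtain ⟨μ, hμ, hμe⟩ := intermediate_value_Icc hM.le hcont ⟨hlo.le, hhi'⟩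
  have hμpos : 0 < μ := by
    rcases hμ.1.eq_or_lt with h | h
    · subst h
      exact absurd hμe hlo.ne
    · exact h
  simp only at hμe
  obtain ⟨R, hR, hS⟩ := exists_slPair_of_pruferAngle hp hpos (hθ μ hμ.1)
  refine ⟨μ, _, _, hS, by simp [hθ0 μ hμ.1], by simp [hμe], fun x hx => mul_pos (hR x) ?_,
    by simpa [hθ0 μ hμ.1] using hR 0, by simpa [hμe] using hR L⟩
  have h1 := hmono μ hμpos ⟨le_rfl, hL.le⟩ (Ioo_subset_Icc_self hx) hx.1
  rw [hθ0 μ hμ.1] at h1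
  have h2 := hmono μ hμpos (Ioo_subset_Icc_self hx) ⟨hL.le, le_rfl⟩ hx.2
  exact Real.sin_pos_of_pos_of_lt_pi h1 (h2.trans_eq hμe)

/-! ### Absolute continuity and the integrating factor -/

section

lemma absolutelyContinuous_of_hasDerivWithinAt {f f' : ℝ → ℝ} {a b : ℝ} (hab : a ≤ b)
    (h : ∀ x ∈ Icc a b, HasDerivWithinAt f (f' x) (Icc a b) x) (hc : ContinuousOn f' (Icc a b)) :
    AbsolutelyContinuousOnInterval f a b := by
  obtain ⟨B, hB⟩ := isCompact_Icc.exists_bound_of_continuousOn hc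
  have hB' : LipschitzOnWith (Real.toNNReal B) f (Icc a b) :=
    (convex_Icc a b).lipschitzOnWith_of_nnnorm_hasDerivWithin_le h fun x hx => by
      rw [← NNReal.coe_le_coe, coe_nnnorm]
      exact (hB x hx).trans (Real.le_coe_toNNReal B)
  exact LipschitzOnWith.absolutelyContinuousOnInterval (by rwa [uIcc_of_le hab])

/-- The coefficient is only bounded and measurable, so Wronskians are differentiable only almost
everywhere; absolute continuity makes an a.e. positive derivative enough for strict growth. -/
lemma lt_of_ae_hasDerivAt_pos {f f' : ℝ → ℝ} {a b : ℝ} (hab : a < b)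
    (hf : AbsolutelyContinuousOnInterval f a b)
    (h : ∀ᵐ x, x ∈ Icc a b → HasDerivAt f (f' x) x ∧ 0 < f' x) : f a < f b := by
  rw [← sub_pos, ← hf.integral_deriv_eq_sub]
  have hpos : ∀ᵐ x ∂volume.restrict (Ioc a b), 0 < deriv f x := by
    rw [ae_restrict_iff' measurableSet_Ioc]
    filter_upwards [h] with x hx hxm
    obtain ⟨h1, h2⟩ := hx (Ioc_subset_Icc_self hxm)
    rwa [h1.deriv]
  have hnn : 0 ≤ᵐ[volume.restrict (Ioc a b)] deriv f := hpos.mono fun x hx => hx.le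
  have hint : IntegrableOn (deriv f) (Ioc a b) := hf.intervalIntegrable_deriv.1
  rw [intervalIntegral.integral_of_le hab.le, integral_pos_iff_support_of_nonneg_ae hnn hint]
  have hsupp : Function.support (deriv f) =ᵐ[volume.restrict (Ioc a b)] univ := by
    filter_upwards [hpos] with x hx
    exact propext ⟨fun _ => trivial, fun _ => hx.ne'⟩
  rw [measure_congr hsupp, Measure.restrict_apply_univ, Real.volume_Ioc]
  simpa using hab

lemma eq_add_integral_of_ae_hasDerivAt {f f' : ℝ → ℝ} {a b : ℝ}
    (hf : AbsolutelyContinuousOnInterval f a b)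
    (h : ∀ᵐ x, x ∈ uIcc a b → HasDerivAt f (f' x) x) : f b = f a + ∫ x in a..b, f' x := by
  rw [← sub_eq_iff_eq_add', ← hf.integral_deriv_eq_sub]
  refine intervalIntegral.integral_congr_ae ?_
  filter_upwards [h] with x hx hxm
  exact (hx (uIoc_subset_uIcc hxm)).deriv

/-- The integrating factor `exp (c ∫₀ˣ k)`. -/
noncomputable def weight (c : ℝ) (k : ℝ → ℝ) (x : ℝ) : ℝ := Real.exp (c * ∫ t in (0 : ℝ)..x, k t)

section weight

variable {c : ℝ} {k : ℝ → ℝ}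

lemma weight_pos (x : ℝ) : 0 < weight c k x := Real.exp_pos _

lemma weight_zero : weight c k 0 = 1 := by simp [weight]

lemma intervalIntegrable_of_locallyIntegrable (hk : LocallyIntegrable k) (a b : ℝ) :
    IntervalIntegrable k volume a b :=
  intervalIntegrable_iff.mpr ((hk.integrableOn_isCompact isCompact_uIcc).mono_set uIoc_subset_uIcc)

lemma continuous_weight (hk : LocallyIntegrable k) : Continuous (weight c k) :=
  Real.continuous_exp.comp (continuous_const.mul
    (intervalIntegral.continuous_primitive (intervalIntegrable_of_locallyIntegrable hk) 0))

lemma ae_hasDerivAt_weight (hk : LocallyIntegrable k) :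
    ∀ᵐ x, HasDerivAt (weight c k) (c * k x * weight c k x) x := by
  filter_upwards [LocallyIntegrable.ae_hasDerivAt_integral hk] with x hx
  convert! ((hx 0).const_mul c).exp using 1
  simp only [weight]
  ring

/-- An absolutely continuous function has bounded range here, and exp is Lipschitz below any bound.
-/
lemma absolutelyContinuous_exp {f : ℝ → ℝ} {a b : ℝ}
    (hf : AbsolutelyContinuousOnInterval f a b) :
    AbsolutelyContinuousOnInterval (fun x => Real.exp (f x)) a b := by
  obtain ⟨B, hB⟩ := hf.exists_bound
  have hlip : ∀ x ∈ uIcc a b, ∀ y ∈ uIcc a b,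
      dist (Real.exp (f x)) (Real.exp (f y)) ≤ Real.exp B * dist (f x) (f y) := by
    intro x hx y hy
    have := (convex_Iic B).norm_image_sub_le_of_norm_hasDerivWithin_le (f := Real.exp)
      (f' := Real.exp) (C := Real.exp B) (fun z _ => (Real.hasDerivAt_exp z).hasDerivWithinAt)
      (fun z hz => by
        rw [Real.norm_of_nonneg (Real.exp_pos z).le]
        exact Real.exp_le_exp.2 hz)
      ((le_abs_self _).trans (hB y hy)) ((le_abs_self _).trans (hB x hx))
    rwa [dist_eq_norm, dist_eq_norm]
  have h0 := Tendsto.const_mul (Real.exp B) hf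
  rw [mul_zero] at h0
  refine squeeze_zero' (Eventually.of_forall fun E => Finset.sum_nonneg fun _ _ => dist_nonneg)
    ?_ h0
  filter_upwards [mem_inf_of_right (mem_principal_self _)] with E hE
  rw [Finset.mul_sum]
  exact Finset.sum_le_sum fun i hi => hlip _ (hE.1 i hi).1 _ (hE.1 i hi).2

lemma absolutelyContinuous_primitive (hk : LocallyIntegrable k) (a b : ℝ) :
    AbsolutelyContinuousOnInterval (fun x => ∫ t in (0 : ℝ)..x, k t) a b := by
  refine ((intervalIntegrable_of_locallyIntegrable hk
    (min 0 (min a b)) (max 0 (max a b))).absolutelyContinuousOnInterval_intervalIntegral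
    (c := 0) ?_).mono ?_
  · exact mem_uIcc_of_le (min_le_left _ _) (le_max_left _ _)
  · rw [uIcc_of_le ((min_le_left 0 (min a b)).trans (le_max_left 0 (max a b)))]
    exact Icc_subset_Icc (min_le_right _ _) (le_max_right _ _)

lemma absolutelyContinuous_weight (hk : LocallyIntegrable k) (a b : ℝ) :
    AbsolutelyContinuousOnInterval (weight c k) a b :=
  absolutelyContinuous_exp ((absolutelyContinuous_primitive hk a b).const_mul c)

end weight

end

/-! ### First variation and the flux of the trial function -/

section

/-- The first-order coefficient of the principal eigenvalue of `(p u')' = -μ p u`,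
`p = exp (c ∫ k)`, in `c`. -/
noncomputable def firstVariation (k : ℝ → ℝ) : ℝ :=
  -(1 / (4 * Real.pi)) * ∫ t in (0 : ℝ)..(2 * Real.pi), k t * Real.sin t

/-- `sin² (x/2)` times the logarithmic derivative of the correction to the trial function. -/
noncomputable def trialFlux (k : ℝ → ℝ) (x : ℝ) : ℝ :=
  -∫ t in (0 : ℝ)..x, (k t * (Real.sin t / 4) + firstVariation k * Real.sin (t / 2) ^ 2)

variable {c : ℝ} {k : ℝ → ℝ}

lemma abs_firstVariation_le (hb : ∀ᵐ x, |k x| ≤ 1) : |firstVariation k| ≤ 1 / 2 := by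
  have h : ‖∫ t in (0 : ℝ)..(2 * Real.pi), k t * Real.sin t‖ ≤
      ∫ t in (0 : ℝ)..(2 * Real.pi), (1 : ℝ) := by
    refine intervalIntegral.norm_integral_le_of_norm_le (by positivity) ?_ (by simp)
    filter_upwards [hb] with t ht _
    rw [norm_mul, Real.norm_eq_abs, Real.norm_eq_abs]
    exact mul_le_one₀ ht (abs_nonneg _) (Real.abs_sin_le_one t)
  simp only [intervalIntegral.integral_const, smul_eq_mul, mul_one, sub_zero, Real.norm_eq_abs] at h
  rw [firstVariation, abs_mul, abs_neg, abs_of_pos (by positivity)]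
  calc _ ≤ 1 / (4 * Real.pi) * (2 * Real.pi) := by gcongr
    _ = 1 / 2 := by field_simp; norm_num

lemma locallyIntegrable_trialFlux (hk : LocallyIntegrable k) : LocallyIntegrable fun t =>
    k t * (Real.sin t / 4) + firstVariation k * Real.sin (t / 2) ^ 2 := by
  refine LocallyIntegrable.add ?_ (Continuous.locallyIntegrable (by fun_prop))
  simp_rw [mul_comm (k _)]
  rw [← locallyIntegrableOn_univ] at hk ⊢
  exact hk.continuousOn_mul (by fun_prop) isOpen_univ.isLocallyClosed

lemma integral_sin_half_sq : ∫ t in (0 : ℝ)..(2 * Real.pi), Real.sin (t / 2) ^ 2 = Real.pi := by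
  have h := intervalIntegral.integral_comp_div (a := 0) (b := 2 * Real.pi) (c := 2)
    (fun t => Real.sin t ^ 2) (by norm_num)
  rw [h]
  simp [integral_sin_sq, mul_div_cancel₀]

/-- This is the solvability condition that determines `firstVariation`: without it the flux divided
by sin²(x/2) would blow up at 2π. -/
lemma trialFlux_two_pi (hk : LocallyIntegrable k) : trialFlux k (2 * Real.pi) = 0 := by
  have h1 : LocallyIntegrable fun t => k t * (Real.sin t / 4) := by
    simp_rw [mul_comm (k _)]
    rw [← locallyIntegrableOn_univ] at hk ⊢
    exact hk.continuousOn_mul (by fun_prop) isOpen_univ.isLocallyClosed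
  rw [trialFlux, intervalIntegral.integral_add (intervalIntegrable_of_locallyIntegrable h1 _ _)
    (Continuous.intervalIntegrable (by fun_prop) _ _), intervalIntegral.integral_const_mul,
    integral_sin_half_sq]
  have h2 : ∫ t in (0 : ℝ)..(2 * Real.pi), k t * (Real.sin t / 4)
      = (∫ t in (0 : ℝ)..(2 * Real.pi), k t * Real.sin t) / 4 := by
    rw [← intervalIntegral.integral_div]
    congr 1
    ext t
    ring
  rw [h2, firstVariation]
  field_simp
  ring

lemma one_sub_cos_eq (x : ℝ) : 1 - Real.cos x = 2 * Real.sin (x / 2) ^ 2 := by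
  have := Real.cos_sq' (x / 2)
  have h2 := Real.cos_two_mul (x / 2)
  rw [show 2 * (x / 2) = x by ring] at h2
  rw [h2, this]
  ring

lemma abs_trialFlux_integrand_le {t A : ℝ} (hb : |k t| ≤ 1) (hm : |firstVariation k| ≤ 1 / 2)
    (hA : Real.sin (t / 2) ^ 2 ≤ A) :
    ‖k t * (Real.sin t / 4) + firstVariation k * Real.sin (t / 2) ^ 2‖
      ≤ |Real.sin t| / 4 + A / 2 := by
  refine (norm_add_le _ _).trans ?_
  rw [norm_mul, norm_mul, Real.norm_eq_abs, Real.norm_eq_abs, Real.norm_eq_abs,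
    Real.norm_of_nonneg (sq_nonneg _), abs_div, abs_of_pos (show (0 : ℝ) < 4 by norm_num)]
  have h1 := mul_le_mul_of_nonneg_right hb (show 0 ≤ |Real.sin t| / 4 by positivity)
  have h2 := mul_le_mul hm hA (sq_nonneg _) (by norm_num)
  linarith

/-- The integrand is at most |sin t|/4 + sin²(t/2)/2. Integrating from the nearer end point, where
the flux vanishes, gives at most (1/2 + π/2)·sin²(x/2), and π < 4 yields 5/2. The split at π makes
sin²(t/2) ≤ sin²(x/2) on the range of integration. -/
lemma abs_trialFlux_le (hk : LocallyIntegrable k) (hb : ∀ᵐ x, |k x| ≤ 1) {x : ℝ}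
    (hx : x ∈ Icc 0 (2 * Real.pi)) : |trialFlux k x| ≤ 5 / 2 * Real.sin (x / 2) ^ 2 := by
  have hm := abs_firstVariation_le hb
  have hpi := Real.pi_lt_four
  have hS := sq_nonneg (Real.sin (x / 2))
  rcases le_total x Real.pi with hxpi | hxpi
  · have h : ‖∫ t in (0 : ℝ)..x,
        (k t * (Real.sin t / 4) + firstVariation k * Real.sin (t / 2) ^ 2)‖
        ≤ ∫ t in (0 : ℝ)..x, (Real.sin t / 4 + Real.sin (x / 2) ^ 2 / 2) := by
      refine intervalIntegral.norm_integral_le_of_norm_le hx.1 ?_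
        (Continuous.intervalIntegrable (by fun_prop) _ _)
      filter_upwards [hb] with t ht htm
      have hsin : |Real.sin t| = Real.sin t :=
        abs_of_nonneg (Real.sin_nonneg_of_nonneg_of_le_pi htm.1.le (htm.2.trans hxpi))
      refine (abs_trialFlux_integrand_le ht hm (A := Real.sin (x / 2) ^ 2) ?_).trans_eq
        (by rw [hsin])
      refine pow_le_pow_left₀ (Real.sin_nonneg_of_nonneg_of_le_pi ?_ ?_)
        (Real.sin_le_sin_of_le_of_le_pi_div_two ?_ ?_ ?_) 2 <;>
      linarith [htm.1, htm.2, Real.pi_pos]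
    have hR : ∫ t in (0 : ℝ)..x, (Real.sin t / 4 + Real.sin (x / 2) ^ 2 / 2)
        = (1 - Real.cos x) / 4 + x * (Real.sin (x / 2) ^ 2 / 2) := by
      rw [intervalIntegral.integral_add (Continuous.intervalIntegrable (by fun_prop) _ _)
        (by simp), intervalIntegral.integral_div, integral_sin]
      simp
      ring
    rw [hR, one_sub_cos_eq] at h
    rw [trialFlux, abs_neg]
    refine h.trans ?_
    nlinarith
  · have h0 := trialFlux_two_pi hk
    have hi := intervalIntegrable_of_locallyIntegrable (locallyIntegrable_trialFlux hk)
    have hJ : trialFlux k x = ∫ t in x..(2 * Real.pi),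
        (k t * (Real.sin t / 4) + firstVariation k * Real.sin (t / 2) ^ 2) := by
      have := intervalIntegral.integral_add_adjacent_intervals (hi 0 x) (hi x (2 * Real.pi))
      rw [trialFlux] at h0 ⊢
      linarith
    have h : ‖∫ t in x..(2 * Real.pi),
        (k t * (Real.sin t / 4) + firstVariation k * Real.sin (t / 2) ^ 2)‖
        ≤ ∫ t in x..(2 * Real.pi), (-Real.sin t / 4 + Real.sin (x / 2) ^ 2 / 2) := by
      refine intervalIntegral.norm_integral_le_of_norm_le hx.2 ?_
        (Continuous.intervalIntegrable (by fun_prop) _ _)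
      filter_upwards [hb] with t ht htm
      have hsin : |Real.sin t| = -Real.sin t := by
        refine abs_of_nonpos ?_
        rw [← Real.sin_sub_two_pi]
        refine Real.sin_nonpos_of_nonpos_of_neg_pi_le ?_ ?_ <;> linarith [htm.1, htm.2]
      rw [← hsin]
      refine abs_trialFlux_integrand_le ht hm ?_
      rw [← Real.sin_pi_sub (t / 2), ← Real.sin_pi_sub (x / 2)]
      refine pow_le_pow_left₀ (Real.sin_nonneg_of_nonneg_of_le_pi ?_ ?_)
        (Real.sin_le_sin_of_le_of_le_pi_div_two ?_ ?_ ?_) 2 <;>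
      linarith [htm.1, htm.2, Real.pi_pos]
    have hR : ∫ t in x..(2 * Real.pi), (-Real.sin t / 4 + Real.sin (x / 2) ^ 2 / 2)
        = (1 - Real.cos x) / 4 + (2 * Real.pi - x) * (Real.sin (x / 2) ^ 2 / 2) := by
      rw [intervalIntegral.integral_add (Continuous.intervalIntegrable (by fun_prop) _ _)
        (by simp), intervalIntegral.integral_div, intervalIntegral.integral_neg, integral_sin]
      simp
      ring
    rw [hR, one_sub_cos_eq] at h
    rw [hJ]
    refine h.trans ?_
    nlinarith

end

/-! ### Comparison of the principal eigenvalue with the trial function -/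

section

variable {c μ : ℝ} {k u v : ℝ → ℝ}

/-- The derivative of the exponent of the correction to the trial function. -/
noncomputable def trialSlope (k : ℝ → ℝ) (x : ℝ) : ℝ := trialFlux k x / Real.sin (x / 2) ^ 2

/-- The correction factor of the trial function `sin (x/2) exp (c ∫ trialSlope)`. -/
noncomputable def trialFactor (c : ℝ) (k : ℝ → ℝ) (x : ℝ) : ℝ :=
  Real.exp (c * ∫ t in Real.pi..x, trialSlope k t)

/-- The Wronskian of a solution and the trial function, without the correction factor. -/
noncomputable def trialWronskian (c : ℝ) (k u v : ℝ → ℝ) (x : ℝ) : ℝ :=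
  v x * Real.sin (x / 2) - weight c k x * (Real.cos (x / 2) / 2) * u x
    - c * weight c k x * (trialFlux k x / Real.sin (x / 2)) * u x

lemma sin_half_pos {x : ℝ} (hx : x ∈ Ioo 0 (2 * Real.pi)) : 0 < Real.sin (x / 2) :=
  Real.sin_pos_of_pos_of_lt_pi (by linarith [hx.1]) (by linarith [hx.2])

lemma continuous_trialFlux (hk : LocallyIntegrable k) : Continuous (trialFlux k) :=
  (intervalIntegral.continuous_primitive
    (intervalIntegrable_of_locallyIntegrable (locallyIntegrable_trialFlux hk)) 0).neg

lemma continuousOn_trialSlope (hk : LocallyIntegrable k) :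
    ContinuousOn (trialSlope k) (Ioo 0 (2 * Real.pi)) :=
  (continuous_trialFlux hk).continuousOn.div (by fun_prop)
    fun _ hx => (pow_pos (sin_half_pos hx) 2).ne'

lemma abs_trialSlope_le (hk : LocallyIntegrable k) (hb : ∀ᵐ x, |k x| ≤ 1) {x : ℝ}
    (hx : x ∈ Ioo 0 (2 * Real.pi)) : |trialSlope k x| ≤ 5 / 2 := by
  have h := pow_pos (sin_half_pos hx) 2
  rw [trialSlope, abs_div, abs_of_pos h, div_le_iff₀ h]
  exact abs_trialFlux_le hk hb (Ioo_subset_Icc_self hx)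

lemma uIcc_pi_subset {x : ℝ} (hx : x ∈ Ioo 0 (2 * Real.pi)) :
    uIcc Real.pi x ⊆ Ioo 0 (2 * Real.pi) :=
  ordConnected_Ioo.uIcc_subset ⟨Real.pi_pos, by linarith [Real.pi_pos]⟩ hx

lemma hasDerivAt_trialFactor (hk : LocallyIntegrable k) {x : ℝ}
    (hx : x ∈ Ioo 0 (2 * Real.pi)) :
    HasDerivAt (trialFactor c k) (c * trialSlope k x * trialFactor c k x) x := by
  have hc := continuousOn_trialSlope hk
  have h := intervalIntegral.integral_hasDerivAt_right
    ((hc.mono (uIcc_pi_subset hx)).intervalIntegrable)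
    (hc.stronglyMeasurableAtFilter isOpen_Ioo x hx) (hc.continuousAt (isOpen_Ioo.mem_nhds hx))
  convert! (h.const_mul c).exp using 1
  simp only [trialFactor]
  ring

lemma trialFactor_pos (x : ℝ) : 0 < trialFactor c k x := Real.exp_pos _

lemma exists_trialFactor_le (hk : LocallyIntegrable k) (hb : ∀ᵐ x, |k x| ≤ 1) :
    ∃ B, ∀ x ∈ Ioo 0 (2 * Real.pi), trialFactor c k x ≤ B := by
  refine ⟨Real.exp (|c| * (5 / 2 * Real.pi)), fun x hx => Real.exp_le_exp.2 ?_⟩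
  refine (le_abs_self _).trans ?_
  rw [abs_mul]
  refine mul_le_mul_of_nonneg_left ?_ (abs_nonneg c)
  have h := intervalIntegral.norm_integral_le_of_norm_le_const (a := Real.pi) (b := x)
    (f := trialSlope k) (C := 5 / 2) fun t ht =>
      abs_trialSlope_le hk hb (uIcc_pi_subset hx (uIoc_subset_uIcc ht))
  rw [Real.norm_eq_abs] at h
  refine h.trans (mul_le_mul_of_nonneg_left ?_ (by norm_num))
  rw [abs_le]
  constructor <;> linarith [hx.1, hx.2]

lemma SLPair.hasDerivAt_fst {p : ℝ → ℝ} {L : ℝ} (h : SLPair p L μ u v) {x : ℝ}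
    (hx : x ∈ Ioo 0 L) : HasDerivAt u (v x / p x) x :=
  (h.hasDeriv_fst x (Ioo_subset_Icc_self hx)).hasDerivAt (Icc_mem_nhds hx.1 hx.2)

lemma SLPair.hasDerivAt_snd {p : ℝ → ℝ} {L : ℝ} (h : SLPair p L μ u v) {x : ℝ}
    (hx : x ∈ Ioo 0 L) : HasDerivAt v (-(μ * p x * u x)) x :=
  (h.hasDeriv_snd x (Ioo_subset_Icc_self hx)).hasDerivAt (Icc_mem_nhds hx.1 hx.2)

lemma SLPair.continuousOn_fst {p : ℝ → ℝ} {L : ℝ} (h : SLPair p L μ u v) :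
    ContinuousOn u (Icc 0 L) := fun x hx => (h.hasDeriv_fst x hx).continuousWithinAt

lemma SLPair.continuousOn_snd {p : ℝ → ℝ} {L : ℝ} (h : SLPair p L μ u v) :
    ContinuousOn v (Icc 0 L) := fun x hx => (h.hasDeriv_snd x hx).continuousWithinAt

/-- The Rayleigh-type quotient of the trial function. -/
noncomputable def trialQuotient (c : ℝ) (k : ℝ → ℝ) (x : ℝ) : ℝ :=
  1 / 4 + c * firstVariation k - c ^ 2 * (trialSlope k x ^ 2 + k x * trialSlope k x)

/-- For φ = sin(x/2)·`trialFactor` the function is vφ - pφ'u, whose derivative is puφ times the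
quotient of φ minus μ. With g = `trialSlope`, the first-order part of that quotient is -c(g' + g
cot(x/2) + κ cot(x/2)/2). It equals cm because (g sin²(x/2))' = -κ sin(x)/4 - m sin²(x/2), which is
the definition of the flux. -/
lemma ae_hasDerivAt_trialWronskian (hk : LocallyIntegrable k)
    (h : SLPair (weight c k) (2 * Real.pi) μ u v) :
    ∀ᵐ x, x ∈ Ioo 0 (2 * Real.pi) →
      HasDerivAt (fun x => trialFactor c k x * trialWronskian c k u v x)
        (trialFactor c k x * weight c k x * u x * Real.sin (x / 2) * (trialQuotient c k x - μ))
        x := by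
  filter_upwards [ae_hasDerivAt_weight (c := c) hk,
    LocallyIntegrable.ae_hasDerivAt_integral (locallyIntegrable_trialFlux hk)] with x hw hJ hx
  have hS := sin_half_pos hx
  have hwp : weight c k x ≠ 0 := (weight_pos x).ne'
  have hJ' : HasDerivAt (trialFlux k) _ x := (hJ 0).neg
  have hs : HasDerivAt (fun x : ℝ => Real.sin (x / 2)) (Real.cos (x / 2) * (1 / 2)) x :=
    ((hasDerivAt_id x).div_const 2).sin
  have hc : HasDerivAt (fun x : ℝ => Real.cos (x / 2)) (-Real.sin (x / 2) * (1 / 2)) x :=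
    ((hasDerivAt_id x).div_const 2).cos
  have hu := h.hasDerivAt_fst hx
  have hv := h.hasDerivAt_snd hx
  have hE := hasDerivAt_trialFactor (c := c) hk hx
  have key := hE.mul (((hv.mul hs).sub ((hw.mul (hc.div_const 2)).mul hu)).sub
    (((hw.const_mul c).mul (hJ'.div hs hS.ne')).mul hu))
  convert! key using 1
  have hsin : Real.sin x = 2 * Real.sin (x / 2) * Real.cos (x / 2) := by
    rw [← Real.sin_two_mul]
    ring_nf
  simp only [trialQuotient, trialSlope, Pi.mul_apply, Pi.sub_apply, Pi.div_apply, hsin]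
  field_simp
  ring

lemma absolutelyContinuous_trialWronskian (hk : LocallyIntegrable k)
    (h : SLPair (weight c k) (2 * Real.pi) μ u v) {a b : ℝ} (ha : 0 < a) (hab : a ≤ b)
    (hb : b < 2 * Real.pi) :
    AbsolutelyContinuousOnInterval
      (fun x => trialFactor c k x * trialWronskian c k u v x) a b := by
  have hsub : Icc a b ⊆ Ioo 0 (2 * Real.pi) := Icc_subset_Ioo ha hb
  have hsub' : Icc a b ⊆ Icc 0 (2 * Real.pi) := hsub.trans Ioo_subset_Icc_self
  have hw := absolutelyContinuous_weight (c := c) hk a b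
  have hwc : Continuous (weight c k) := continuous_weight hk
  have hE : AbsolutelyContinuousOnInterval (trialFactor c k) a b :=
    absolutelyContinuous_of_hasDerivWithinAt hab
      (fun x hx => (hasDerivAt_trialFactor hk (hsub hx)).hasDerivWithinAt)
      ((continuousOn_const.mul ((continuousOn_trialSlope hk).mono hsub)).mul
        fun x hx => (hasDerivAt_trialFactor hk (hsub hx)).continuousAt.continuousWithinAt)
  have hu : AbsolutelyContinuousOnInterval u a b :=
    absolutelyContinuous_of_hasDerivWithinAt hab
      (fun x hx => (h.hasDerivAt_fst (hsub hx)).hasDerivWithinAt)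
      ((h.continuousOn_snd.mono hsub').div hwc.continuousOn fun x _ => (weight_pos x).ne')
  have hv : AbsolutelyContinuousOnInterval v a b :=
    absolutelyContinuous_of_hasDerivWithinAt hab
      (fun x hx => (h.hasDerivAt_snd (hsub hx)).hasDerivWithinAt)
      (((continuousOn_const.mul hwc.continuousOn).mul (h.continuousOn_fst.mono hsub')).neg)
  have hs : AbsolutelyContinuousOnInterval (fun x : ℝ => Real.sin (x / 2)) a b :=
    ContDiffOn.absolutelyContinuousOnInterval (by fun_prop)
  have hc : AbsolutelyContinuousOnInterval (fun x : ℝ => Real.cos (x / 2) / 2) a b :=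
    ContDiffOn.absolutelyContinuousOnInterval (by fun_prop)
  have hsi : AbsolutelyContinuousOnInterval (fun x : ℝ => (Real.sin (x / 2))⁻¹) a b := by
    refine ContDiffOn.absolutelyContinuousOnInterval ?_
    rw [uIcc_of_le hab]
    exact ContDiffOn.inv (by fun_prop) fun x hx => (sin_half_pos (hsub hx)).ne'
  have hJ : AbsolutelyContinuousOnInterval (trialFlux k) a b :=
    (absolutelyContinuous_primitive (locallyIntegrable_trialFlux hk) a b).neg
  exact hE.mul (((hv.mul hs).sub ((hw.mul hc).mul hu)).sub
    (((hw.const_mul c).mul (hJ.mul hsi)).mul hu))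

/-- A product `E * Y` with `E` positive and bounded cannot be strictly increasing if `Y` tends to
zero at the left end point and to a nonpositive number at the right end point. -/
lemma not_strictMonoOn_of_tendsto {E Y : ℝ → ℝ} {a b B ℓ : ℝ} (hab : a < b)
    (hE : ∀ x ∈ Ioo a b, 0 < E x) (hEB : ∀ x ∈ Ioo a b, E x ≤ B)
    (ha : Tendsto Y (𝓝[Ioo a b] a) (𝓝 0)) (hb : Tendsto Y (𝓝[Ioo a b] b) (𝓝 ℓ)) (hℓ : ℓ ≤ 0)
    (h : StrictMonoOn (fun x => E x * Y x) (Ioo a b)) : False := by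
  have hna : (𝓝[Ioo a b] a).NeBot := left_nhdsWithin_Ioo_neBot hab
  have hnb : (𝓝[Ioo a b] b).NeBot := right_nhdsWithin_Ioo_neBot hab
  obtain ⟨x₀, hx₀⟩ : (Ioo a b).Nonempty := nonempty_Ioo.2 hab
  obtain ⟨x₁, hx₁⟩ : (Ioo x₀ b).Nonempty := nonempty_Ioo.2 hx₀.2
  have hx₁' : x₁ ∈ Ioo a b := ⟨hx₀.1.trans hx₁.1, hx₁.2⟩
  have hlim : Tendsto (fun x => E x * Y x) (𝓝[Ioo a b] a) (𝓝 0) := by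
    refine squeeze_zero_norm' (a := fun x => B * |Y x|) ?_ (by simpa using ha.abs.const_mul B)
    filter_upwards [self_mem_nhdsWithin] with x hx
    rw [norm_mul, Real.norm_of_nonneg (hE x hx).le, Real.norm_eq_abs]
    exact mul_le_mul_of_nonneg_right (hEB x hx) (abs_nonneg _)
  have h0 : 0 ≤ E x₀ * Y x₀ := by
    refine le_of_tendsto hlim ?_
    filter_upwards [self_mem_nhdsWithin, mem_nhdsWithin_of_mem_nhds (Iio_mem_nhds hx₀.1)]
      with x hx hxx
    exact (h hx hx₀ hxx).le
  have h1 : 0 < E x₁ * Y x₁ := h0.trans_lt (h hx₀ hx₁' hx₁.1)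
  have hB : 0 < B := (hE x₀ hx₀).trans_le (hEB x₀ hx₀)
  have h2 : E x₁ * Y x₁ / B ≤ ℓ := by
    refine ge_of_tendsto hb ?_
    filter_upwards [self_mem_nhdsWithin, mem_nhdsWithin_of_mem_nhds (Ioi_mem_nhds hx₁.2)]
      with x hx hxx
    have h3 : E x₁ * Y x₁ < E x * Y x := h hx₁' hx hxx
    have h4 : 0 < Y x := pos_of_mul_pos_right (h1.trans h3) (hE x hx).le
    rw [div_le_iff₀ hB, mul_comm _ B]
    exact h3.le.trans (mul_le_mul_of_nonneg_right (hEB x hx) h4.le)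
  have : 0 < E x₁ * Y x₁ / B := by positivity
  linarith

/-- The only singular term, flux divided by sin(x/2), tends to 0 because the flux is O(sin²(x/2)).
-/
lemma tendsto_trialWronskian (hk : LocallyIntegrable k) (hb : ∀ᵐ x, |k x| ≤ 1)
    (h : SLPair (weight c k) (2 * Real.pi) μ u v) {z : ℝ} (hz : z ∈ Icc 0 (2 * Real.pi))
    (hz0 : Real.sin (z / 2) = 0) :
    Tendsto (trialWronskian c k u v) (𝓝[Ioo 0 (2 * Real.pi)] z)
      (𝓝 (-(weight c k z * (Real.cos (z / 2) / 2) * u z))) := by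
  have hle : 𝓝[Ioo 0 (2 * Real.pi)] z ≤ 𝓝[Icc 0 (2 * Real.pi)] z :=
    nhdsWithin_mono _ Ioo_subset_Icc_self
  have hu : Tendsto u (𝓝[Ioo 0 (2 * Real.pi)] z) (𝓝 (u z)) := (h.continuousOn_fst z hz).mono_left hle
  have hv : Tendsto v (𝓝[Ioo 0 (2 * Real.pi)] z) (𝓝 (v z)) := (h.continuousOn_snd z hz).mono_left hle
  have hw : Tendsto (weight c k) (𝓝[Ioo 0 (2 * Real.pi)] z) (𝓝 (weight c k z)) :=
    ((continuous_weight hk).tendsto z).mono_left nhdsWithin_le_nhds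
  have hs : Tendsto (fun x : ℝ => Real.sin (x / 2)) (𝓝[Ioo 0 (2 * Real.pi)] z)
      (𝓝 (Real.sin (z / 2))) :=
    (Continuous.tendsto (by fun_prop) z).mono_left nhdsWithin_le_nhds
  have hc : Tendsto (fun x : ℝ => Real.cos (x / 2) / 2) (𝓝[Ioo 0 (2 * Real.pi)] z)
      (𝓝 (Real.cos (z / 2) / 2)) :=
    (Continuous.tendsto (by fun_prop) z).mono_left nhdsWithin_le_nhds
  have hJ : Tendsto (fun x => trialFlux k x / Real.sin (x / 2)) (𝓝[Ioo 0 (2 * Real.pi)] z)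
      (𝓝 0) := by
    refine squeeze_zero_norm' (a := fun x => 5 / 2 * |Real.sin (x / 2)|) ?_
      (by simpa [hz0] using hs.abs.const_mul (5 / 2))
    filter_upwards [self_mem_nhdsWithin] with x hx
    have hS := sin_half_pos hx
    rw [norm_div, Real.norm_eq_abs, Real.norm_eq_abs, div_le_iff₀ (abs_pos.2 hS.ne'), mul_assoc,
      abs_mul_abs_self, ← pow_two]
    exact abs_trialFlux_le hk hb (Ioo_subset_Icc_self hx)
  have := ((hv.mul hs).sub ((hw.mul hc).mul hu)).sub (((hw.const_mul c).mul hJ).mul hu)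
  rw [hz0] at this
  simp only [mul_zero, zero_mul, zero_sub, sub_zero] at this
  exact this

lemma abs_trialQuotient_sub_le (hk : LocallyIntegrable k) (hb : ∀ᵐ x, |k x| ≤ 1) {x : ℝ}
    (hx : x ∈ Ioo 0 (2 * Real.pi)) (hkx : |k x| ≤ 1) :
    |trialQuotient c k x - (1 / 4 + c * firstVariation k)| ≤ 9 * c ^ 2 := by
  have hg := abs_trialSlope_le hk hb hx
  -- The slope is at most 5/2, so the sum is at most 25/4 + 5/2 ≤ 9; this is the source of the
  -- constant 9.
  have h1 : |trialSlope k x ^ 2 + k x * trialSlope k x| ≤ 9 := by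
    refine (abs_add_le _ _).trans ?_
    rw [abs_mul, abs_pow]
    nlinarith [abs_nonneg (trialSlope k x), abs_nonneg (k x)]
  have h2 : trialQuotient c k x - (1 / 4 + c * firstVariation k)
      = -(c ^ 2 * (trialSlope k x ^ 2 + k x * trialSlope k x)) := by
    rw [trialQuotient]
    ring
  rw [h2, abs_neg, abs_mul, abs_of_nonneg (sq_nonneg c)]
  nlinarith [sq_nonneg c]

/-- If μ exceeded every value of the quotient, minus the Wronskian would increase strictly from 0 to
a limit that is nonpositive as u(2π) ≥ 0. Allowing u(2π) > 0 serves twice: it excludes positive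
solutions for large μ in the shooting argument, and it bounds the eigenvalue. -/
lemma le_of_slPair_of_nonneg (hk : LocallyIntegrable k) (hb : ∀ᵐ x, |k x| ≤ 1)
    (h : SLPair (weight c k) (2 * Real.pi) μ u v) (hu0 : u 0 = 0) (huL : 0 ≤ u (2 * Real.pi))
    (hu : ∀ x ∈ Ioo 0 (2 * Real.pi), 0 < u x) :
    μ ≤ 1 / 4 + c * firstVariation k + 9 * c ^ 2 := by
  by_contra! hlt
  have h2pi : (0 : ℝ) < 2 * Real.pi := by positivity
  obtain ⟨B, hB⟩ := exists_trialFactor_le (c := c) hk hb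
  refine not_strictMonoOn_of_tendsto (E := trialFactor c k)
    (Y := fun x => -trialWronskian c k u v x) h2pi (fun x _ => trialFactor_pos x) hB
    (ℓ := -(weight c k (2 * Real.pi) * (1 / 2) * u (2 * Real.pi))) ?_ ?_ ?_ ?_
  · simpa [hu0] using (tendsto_trialWronskian hk hb h (z := 0) ⟨le_rfl, h2pi.le⟩ (by simp)).neg
  · have := (tendsto_trialWronskian hk hb h (z := 2 * Real.pi) ⟨h2pi.le, le_rfl⟩ (by simp)).neg
    simp only [mul_div_cancel_left₀ Real.pi (two_ne_zero' ℝ), Real.cos_pi] at this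
    convert! this using 2
    ring
  · have := mul_nonneg (weight_pos (c := c) (k := k) (2 * Real.pi)).le huL
    linarith
  · intro a ha b hb' hab
    refine lt_of_ae_hasDerivAt_pos hab
      (f := fun x => trialFactor c k x * -trialWronskian c k u v x)
      (f' := fun x => -(trialFactor c k x * weight c k x * u x *
      Real.sin (x / 2) * (trialQuotient c k x - μ))) ?_ ?_
    · simpa only [mul_neg] using (absolutelyContinuous_trialWronskian hk h ha.1 hab.le hb'.2).fun_neg
    · filter_upwards [ae_hasDerivAt_trialWronskian hk h, hb] with x hx hkx hxm
      have hxm' : x ∈ Ioo 0 (2 * Real.pi) := Icc_subset_Ioo ha.1 hb'.2 hxm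
      refine ⟨by simpa only [mul_neg] using (hx hxm').fun_neg, ?_⟩
      have hq := (abs_le.1 (abs_trialQuotient_sub_le (c := c) hk hb hxm' hkx)).2
      rw [← mul_neg, neg_sub]
      exact mul_pos (mul_pos (mul_pos (mul_pos (trialFactor_pos x) (weight_pos x)) (hu x hxm'))
        (sin_half_pos hxm')) (by linarith)

/-- If μ were below every value of the quotient, the Wronskian would increase strictly from 0 to 0.
-/
lemma ge_of_slPair (hk : LocallyIntegrable k) (hb : ∀ᵐ x, |k x| ≤ 1)
    (h : SLPair (weight c k) (2 * Real.pi) μ u v) (hu0 : u 0 = 0) (huL : u (2 * Real.pi) = 0)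
    (hu : ∀ x ∈ Ioo 0 (2 * Real.pi), 0 < u x) :
    1 / 4 + c * firstVariation k - 9 * c ^ 2 ≤ μ := by
  by_contra! hlt
  have h2pi : (0 : ℝ) < 2 * Real.pi := by positivity
  obtain ⟨B, hB⟩ := exists_trialFactor_le (c := c) hk hb
  refine not_strictMonoOn_of_tendsto (E := trialFactor c k)
    (Y := trialWronskian c k u v) h2pi (fun x _ => trialFactor_pos x) hB (ℓ := 0) ?_ ?_ le_rfl ?_
  · simpa [hu0] using tendsto_trialWronskian hk hb h (z := 0) ⟨le_rfl, h2pi.le⟩ (by simp)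
  · simpa [huL] using
      tendsto_trialWronskian hk hb h (z := 2 * Real.pi) ⟨h2pi.le, le_rfl⟩ (by simp)
  · intro a ha b hb' hab
    refine lt_of_ae_hasDerivAt_pos hab (f' := fun x => trialFactor c k x * weight c k x * u x *
      Real.sin (x / 2) * (trialQuotient c k x - μ))
      (absolutelyContinuous_trialWronskian hk h ha.1 hab.le hb'.2) ?_
    filter_upwards [ae_hasDerivAt_trialWronskian hk h, hb] with x hx hkx hxm
    have hxm' : x ∈ Ioo 0 (2 * Real.pi) := Icc_subset_Ioo ha.1 hb'.2 hxm
    refine ⟨hx hxm', ?_⟩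
    have hq := (abs_le.1 (abs_trialQuotient_sub_le (c := c) hk hb hxm' hkx)).1
    exact mul_pos (mul_pos (mul_pos (mul_pos (trialFactor_pos x) (weight_pos x)) (hu x hxm'))
        (sin_half_pos hxm')) (by linarith)

/-- The principal eigenvalue exists and obeys the second-order bound for every `c`. -/
theorem exists_principal_slPair_weight (hk : LocallyIntegrable k) (hb : ∀ᵐ x, |k x| ≤ 1) (c : ℝ) :
    ∃ μ u v, SLPair (weight c k) (2 * Real.pi) μ u v ∧ u 0 = 0 ∧ u (2 * Real.pi) = 0 ∧
      (∀ x ∈ Ioo 0 (2 * Real.pi), 0 < u x) ∧ 0 < v 0 ∧ v (2 * Real.pi) < 0 ∧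
      |μ - 1 / 4 - c * firstVariation k| ≤ 9 * c ^ 2 := by
  obtain ⟨M, hM0, hM⟩ : ∃ M, 0 < M ∧ 1 / 4 + c * firstVariation k + 9 * c ^ 2 < M :=
    ⟨max 0 (1 / 4 + c * firstVariation k + 9 * c ^ 2) + 1, by positivity,
      (le_max_right _ _).trans_lt (lt_add_one _)⟩
  obtain ⟨μ, u, v, h, hu0, huL, hu, hv0, hvL⟩ := exists_principal_slPair
    (continuous_weight (c := c) hk) weight_pos (L := 2 * Real.pi) (by positivity) hM0
    fun u v huv hu0 hpos => by
      refine absurd (le_of_slPair_of_nonneg hk hb huv hu0 ?_ ?_) (not_le.2 hM)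
      · exact (hpos _ ⟨by positivity, le_rfl⟩).le
      · exact fun x hx => hpos x (Ioo_subset_Ioc_self hx)
  refine ⟨μ, u, v, h, hu0, huL, hu, hv0, hvL, ?_⟩
  have h1 := le_of_slPair_of_nonneg hk hb h hu0 huL.ge hu
  have h2 := ge_of_slPair hk hb h hu0 huL hu
  rw [abs_le]
  constructor <;> linarith

end

/-! ### Exact lower bound for the bang-bang profile -/

section

variable {c μ : ℝ} {u v : ℝ → ℝ}

lemma bangBang_of_lt {x : ℝ} (hx : x < Real.pi) : bangBang x = -1 := by
  simp only [bangBang, heaviside, sub_nonneg, not_le.2 hx, if_false]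
  norm_num

lemma bangBang_of_le {x : ℝ} (hx : Real.pi ≤ x) : bangBang x = 1 := by
  simp only [bangBang, heaviside, sub_nonneg, hx, if_true]
  norm_num

lemma integral_bangBang_left {x : ℝ} (hx : x ∈ Icc 0 Real.pi) :
    ∫ t in (0 : ℝ)..x, dom.indicator bangBang t = -x := by
  have : ∫ t in (0 : ℝ)..x, dom.indicator bangBang t = ∫ t in (0 : ℝ)..x, (-1 : ℝ) := by
    refine intervalIntegral.integral_congr_ae ?_
    filter_upwards [Measure.ae_ne volume Real.pi] with t ht htm
    rw [uIoc_of_le hx.1] at htm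
    have : t ≤ Real.pi := htm.2.trans hx.2
    rw [indicator_of_mem (show t ∈ dom from ⟨htm.1.le, by linarith [Real.pi_pos]⟩),
      bangBang_of_lt (lt_of_le_of_ne this ht)]
  simp [this]

lemma integral_bangBang_mid {x : ℝ} (hx : x ∈ Icc Real.pi (2 * Real.pi)) :
    ∫ t in Real.pi..x, dom.indicator bangBang t = x - Real.pi := by
  have : ∫ t in Real.pi..x, dom.indicator bangBang t = ∫ t in Real.pi..x, (1 : ℝ) := by
    refine intervalIntegral.integral_congr fun t ht => ?_
    rw [uIcc_of_le hx.1] at ht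
    have h0 := Real.pi_pos
    rw [indicator_of_mem (show t ∈ dom from ⟨h0.le.trans ht.1, ht.2.trans hx.2⟩), bangBang_of_le ht.1]
  simp [this]

lemma measurable_bangBang : Measurable bangBang := by
  unfold bangBang heaviside
  refine Measurable.const_mul (Measurable.sub_const (Measurable.ite ?_ measurable_const
    measurable_const) _) _
  exact measurableSet_le measurable_const (measurable_id.sub_const _)

lemma abs_bangBang (x : ℝ) : |bangBang x| = 1 := by
  rcases lt_or_ge x Real.pi with h | h
  · simp [bangBang_of_lt h]
  · simp [bangBang_of_le h]

lemma locallyIntegrable_of_ae_abs_le {k : ℝ → ℝ} (hm : AEStronglyMeasurable k)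
    (hb : ∀ᵐ x, |k x| ≤ 1) : LocallyIntegrable k := by
  rw [locallyIntegrable_iff]
  intro K hK
  refine Measure.integrableOn_of_bounded (M := 1) hK.measure_lt_top.ne hm ?_
  exact ae_restrict_of_ae hb

lemma locallyIntegrable_indicator_bangBang : LocallyIntegrable (dom.indicator bangBang) := by
  refine locallyIntegrable_of_ae_abs_le
    (measurable_bangBang.indicator measurableSet_Icc).aestronglyMeasurable
    (Eventually.of_forall fun x => ?_)
  by_cases hx : x ∈ dom
  · rw [indicator_of_mem hx, abs_bangBang]
  · simp [indicator_of_notMem hx]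

lemma weight_bangBang_left {x : ℝ} (hx : x ∈ Icc 0 Real.pi) :
    weight c (dom.indicator bangBang) x = Real.exp (-(c * x)) := by
  rw [weight, integral_bangBang_left hx, mul_neg]

/-- The profile is odd about π, so its weight is even about π. -/
lemma weight_bangBang_right {x : ℝ} (hx : x ∈ Icc 0 Real.pi) :
    weight c (dom.indicator bangBang) (2 * Real.pi - x) = Real.exp (-(c * x)) := by
  have hi := intervalIntegrable_of_locallyIntegrable locallyIntegrable_indicator_bangBang
  rw [weight, ← intervalIntegral.integral_add_adjacent_intervals (hi 0 Real.pi) (hi Real.pi _),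
    integral_bangBang_left ⟨Real.pi_pos.le, le_rfl⟩,
    integral_bangBang_mid ⟨by linarith [hx.2], by linarith [hx.1]⟩]
  congr 1
  ring

/-- On a half interval, a positive solution below the threshold `1/4 + c²/4` is still increasing
at the right end point. -/
lemma snd_pos_of_lt (hc : 0 ≤ c)
    (h : SLPair (fun x => Real.exp (-(c * x))) Real.pi μ u v) (hu0 : u 0 = 0)
    (hu : ∀ x ∈ Ioc 0 Real.pi, 0 < u x) (hμ : μ < 1 / 4 + c ^ 2 / 4) : 0 < v Real.pi := by
  have hpi := Real.pi_pos
  set F : ℝ → ℝ := fun x => Real.exp (c * x / 2) with hF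
  have hFp : ∀ x, Real.exp (-(c * x)) = (F x ^ 2)⁻¹ := by
    intro x
    rw [hF, ← Real.exp_nat_mul, ← Real.exp_neg]
    congr 1
    push_cast
    ring
  have hF0 : ∀ x, 0 < F x := fun x => Real.exp_pos _
  -- Wronskian with φ = exp(cx/2) sin(x/2), which solves φ'' - cφ' = -(1/4 + c²/4)φ exactly. At π it
  -- equals F·v minus a nonnegative term, so its positivity forces v(π) > 0.
  set y : ℝ → ℝ := fun x => F x * (v x * Real.sin (x / 2))
    - (F x)⁻¹ * ((c / 2 * Real.sin (x / 2) + Real.cos (x / 2) / 2) * u x) with hy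
  have hyc : ContinuousOn y (Icc 0 Real.pi) := by
    have hFc : Continuous F := by fun_prop
    have hFi : Continuous fun x => (F x)⁻¹ := hFc.inv₀ fun x => (hF0 x).ne'
    exact (hFc.continuousOn.mul (h.continuousOn_snd.mul (by fun_prop))).sub
      (hFi.continuousOn.mul (ContinuousOn.mul (by fun_prop) h.continuousOn_fst))
  have hmono : StrictMonoOn y (Icc 0 Real.pi) := by
    refine strictMonoOn_of_deriv_pos (convex_Icc _ _) hyc fun x hx => ?_
    rw [interior_Icc] at hx
    have hs : HasDerivAt (fun x : ℝ => Real.sin (x / 2)) (Real.cos (x / 2) * (1 / 2)) x :=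
      ((hasDerivAt_id x).div_const 2).sin
    have hcs : HasDerivAt (fun x : ℝ => Real.cos (x / 2)) (-Real.sin (x / 2) * (1 / 2)) x :=
      ((hasDerivAt_id x).div_const 2).cos
    have hFd : HasDerivAt F (F x * (c / 2)) x := by
      have := (((hasDerivAt_id x).const_mul c).div_const 2).exp
      simpa using this
    have hud := h.hasDerivAt_fst hx
    have hvd := h.hasDerivAt_snd hx
    have hFx := (hF0 x).ne'
    have key : HasDerivAt y (u x * Real.sin (x / 2) * (F x)⁻¹ * (1 / 4 + c ^ 2 / 4 - μ)) x := by
      convert! (hFd.mul (hvd.mul hs)).sub ((hFd.inv hFx).mul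
        (((hs.const_mul (c / 2)).add (hcs.div_const 2)).mul hud)) using 1
      simp only [Pi.mul_apply, Pi.add_apply, Pi.inv_apply, hFp]
      field_simp
      ring
    rw [key.deriv]
    have h1 : 0 < Real.sin (x / 2) :=
      Real.sin_pos_of_pos_of_lt_pi (by linarith [hx.1]) (by linarith [hx.2])
    have h2 := hu x (Ioo_subset_Ioc_self hx)
    have h3 := inv_pos.2 (hF0 x)
    have h4 : 0 < 1 / 4 + c ^ 2 / 4 - μ := by linarith
    positivity
  have h1 := hmono ⟨le_rfl, hpi.le⟩ ⟨hpi.le, le_rfl⟩ hpi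
  simp only [hy, hu0, zero_div, Real.sin_zero, mul_zero, sub_zero, Real.sin_pi_div_two,
    Real.cos_pi_div_two, mul_one, add_zero] at h1
  have h2 : 0 ≤ (F Real.pi)⁻¹ * (c / 2 * u Real.pi) := by
    have := hu Real.pi ⟨hpi, le_rfl⟩
    have := hF0 Real.pi
    positivity
  exact pos_of_mul_pos_right (by linarith) (hF0 Real.pi).le

/-- The principal eigenvalue of the bang-bang profile is at least `1/4 + c²/4`. -/
theorem le_principal_bangBang (hc : 0 ≤ c)
    (h : SLPair (weight c (dom.indicator bangBang)) (2 * Real.pi) μ u v) (hu0 : u 0 = 0)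
    (huL : u (2 * Real.pi) = 0) (hu : ∀ x ∈ Ioo 0 (2 * Real.pi), 0 < u x) :
    1 / 4 + c ^ 2 / 4 ≤ μ := by
  by_contra! hlt
  have hpi := Real.pi_pos
  have hsub : Icc 0 Real.pi ⊆ Icc 0 (2 * Real.pi) := Icc_subset_Icc_right (by linarith)
  have hleft : SLPair (fun x => Real.exp (-(c * x))) Real.pi μ u v := by
    refine ⟨fun x hx => ?_, fun x hx => ?_⟩
    · simpa only [weight_bangBang_left hx] using (h.hasDeriv_fst x (hsub hx)).mono hsub
    · simpa only [weight_bangBang_left hx] using (h.hasDeriv_snd x (hsub hx)).mono hsub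
  have hmaps : MapsTo (fun x => 2 * Real.pi - x) (Icc 0 Real.pi) (Icc 0 (2 * Real.pi)) :=
    fun x hx => ⟨by linarith [hx.2], by linarith [hx.1]⟩
  have hd : ∀ x, HasDerivWithinAt (fun x => 2 * Real.pi - x) (-1) (Icc 0 Real.pi) x := fun x =>
    ((hasDerivAt_id x).const_sub (2 * Real.pi)).hasDerivWithinAt
  -- Reflection about π turns the right half into the same problem with the flux reversed, so the
  -- half-interval lemma yields both v(π) > 0 and -v(π) > 0.
  have hright : SLPair (fun x => Real.exp (-(c * x))) Real.pi μ
      (fun x => u (2 * Real.pi - x)) (fun x => -v (2 * Real.pi - x)) := by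
    refine ⟨fun x hx => ?_, fun x hx => ?_⟩
    · convert! (h.hasDeriv_fst _ (hmaps hx)).comp x (hd x) hmaps using 1
      rw [weight_bangBang_right hx]
      ring
    · convert! ((h.hasDeriv_snd _ (hmaps hx)).comp x (hd x) hmaps).neg using 1
      rw [weight_bangBang_right hx]
      ring
  have h1 := snd_pos_of_lt hc hleft hu0 (fun x hx => hu x ⟨hx.1, by linarith [hx.2]⟩) hlt
  have h2 := snd_pos_of_lt hc hright (by simpa using huL)
    (fun x hx => hu _ ⟨by linarith [hx.2], by linarith [hx.1]⟩) hlt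
  rw [show 2 * Real.pi - Real.pi = Real.pi by ring] at h2
  linarith

end

/-! ### Complex eigenvalues: reality and minimality of the principal one -/

/-- The quotient of two functions vanishing at the same point tends to the quotient of the
derivatives. -/
lemma tendsto_div_of_hasDerivWithinAt {f : ℝ → ℂ} {g : ℝ → ℝ} {f' : ℂ} {g' z : ℝ} {s : Set ℝ}
    (hz : z ∉ s) (hf : HasDerivWithinAt f f' s z) (hg : HasDerivWithinAt g g' s z)
    (hf0 : f z = 0) (hg0 : g z = 0) (hg' : g' ≠ 0) :
    Tendsto (fun x => f x / (g x : ℂ)) (𝓝[s] z) (𝓝 (f' / g')) := by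
  rw [hasDerivWithinAt_iff_tendsto_slope' hz] at hf hg
  have h := hf.div ((Complex.continuous_ofReal.tendsto g').comp hg)
    (Complex.ofReal_ne_zero.2 hg')
  refine h.congr' ?_
  filter_upwards [self_mem_nhdsWithin] with x hx
  have hxz : x - z ≠ 0 := sub_ne_zero.2 fun h => hz (h ▸ hx)
  have hxz' : (x : ℂ) - z ≠ 0 := by exact_mod_cast hxz
  simp only [Pi.div_apply, slope_def_module, Function.comp_apply, hf0, hg0, sub_zero,
    smul_eq_mul, Complex.real_smul]
  push_cast
  field_simp

/-- A function on an open interval with nonnegative derivative tending to zero at both ends has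
derivative zero. -/
lemma deriv_eq_zero_of_tendsto_zero {f f' : ℝ → ℝ} {a b : ℝ}
    (hf : ∀ x ∈ Ioo a b, HasDerivAt f (f' x) x) (hf' : ∀ x ∈ Ioo a b, 0 ≤ f' x)
    (ha : Tendsto f (𝓝[Ioo a b] a) (𝓝 0)) (hb : Tendsto f (𝓝[Ioo a b] b) (𝓝 0)) :
    ∀ x ∈ Ioo a b, f' x = 0 := by
  intro x hx
  have hab : a < b := hx.1.trans hx.2
  have hna : (𝓝[Ioo a b] a).NeBot := left_nhdsWithin_Ioo_neBot hab
  have hnb : (𝓝[Ioo a b] b).NeBot := right_nhdsWithin_Ioo_neBot hab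
  have hmono : MonotoneOn f (Ioo a b) := by
    refine monotoneOn_of_deriv_nonneg (convex_Ioo a b)
      (fun x hx => (hf x hx).continuousAt.continuousWithinAt) (fun x hx => ?_) fun x hx => ?_
    · exact (hf x (interior_subset hx)).differentiableAt.differentiableWithinAt
    · rw [(hf x (interior_subset hx)).deriv]
      exact hf' x (interior_subset hx)
  have hz : ∀ y ∈ Ioo a b, f y = 0 := by
    intro y hy
    refine le_antisymm ?_ ?_
    · refine ge_of_tendsto hb ?_
      filter_upwards [self_mem_nhdsWithin, mem_nhdsWithin_of_mem_nhds (Ioi_mem_nhds hy.2)]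
        with t ht hty using hmono hy ht (le_of_lt hty)
    · refine le_of_tendsto ha ?_
      filter_upwards [self_mem_nhdsWithin, mem_nhdsWithin_of_mem_nhds (Iio_mem_nhds hy.1)]
        with t ht hty using hmono ht hy (le_of_lt hty)
  have h0 : HasDerivAt f 0 x := (hasDerivAt_const x (0 : ℝ)).congr_of_eventuallyEq
    (by filter_upwards [isOpen_Ioo.mem_nhds hx] with y hy using hz y hy)
  exact (hf x hx).unique h0

/-- A complex solution of `(p η')' = -μ p η` on `[0, L]`, as a first-order system. -/
structure SLPairC (p : ℝ → ℝ) (L : ℝ) (μ : ℂ) (η V : ℝ → ℂ) : Prop where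
  hasDeriv_fst : ∀ x ∈ Icc 0 L, HasDerivWithinAt η (V x / p x) (Icc 0 L) x
  hasDeriv_snd : ∀ x ∈ Icc 0 L, HasDerivWithinAt V (-(μ * p x * η x)) (Icc 0 L) x

/-- Complex Dirichlet eigenvalues are real and not below the one with a positive eigenfunction. -/
theorem real_and_ge_of_slPairC {p : ℝ → ℝ} (hpos : ∀ x, 0 < p x) {L μ₁ : ℝ}
    {u v : ℝ → ℝ} (h : SLPair p L μ₁ u v) (hu0 : u 0 = 0) (huL : u L = 0)
    (hu : ∀ x ∈ Ioo 0 L, 0 < u x) (hv0 : 0 < v 0) (hvL : v L < 0)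
    {μ : ℂ} {η V : ℝ → ℂ} (hη : SLPairC p L μ η V) (hη0 : η 0 = 0) (hηL : η L = 0)
    (hne : ∃ x ∈ Icc 0 L, η x ≠ 0) : μ.im = 0 ∧ μ₁ ≤ μ.re := by
  obtain ⟨x₀, hx₀, hηx₀⟩ := hne
  have hx₀' : x₀ ∈ Ioo 0 L := by
    refine ⟨lt_of_le_of_ne hx₀.1 fun h => hηx₀ (h ▸ hη0), lt_of_le_of_ne hx₀.2 fun h => hηx₀ ?_⟩
    rw [h, hηL]
  -- Picone's identity: Z' = (μ₁ - μ)p|η|² + |Vu - vη|²/(pu²). The imaginary part of Z' has constant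
  -- sign, and so has the real part if Re μ < μ₁.
  set Z : ℝ → ℂ := fun x => (V x * u x - v x * η x) * (starRingEnd ℂ (η x) / u x) with hZ
  set W : ℝ → ℝ := fun x => Complex.normSq (V x * u x - v x * η x) / (p x * u x ^ 2) with hW
  -- The zeros of u at the end points are simple since v ≠ 0 there, so η/u stays bounded while Vu -
  -- vη tends to 0.
  have hlim : ∀ z, z ∈ Icc 0 L → z ∉ Ioo 0 L → u z = 0 → η z = 0 → v z ≠ 0 →
      Tendsto Z (𝓝[Ioo 0 L] z) (𝓝 0) := by
    intro z hz hz' huz hηz hvz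
    have h1 := ((Complex.continuous_conj.tendsto _).comp
      (tendsto_div_of_hasDerivWithinAt hz' ((hη.hasDeriv_fst z hz).mono Ioo_subset_Icc_self)
      ((h.hasDeriv_fst z hz).mono Ioo_subset_Icc_self) hηz huz
      (div_ne_zero hvz (hpos z).ne')))
    have cts {f : ℝ → ℂ} {f' : ℂ} (hf : HasDerivWithinAt f f' (Icc 0 L) z) :
        Tendsto f (𝓝[Ioo 0 L] z) (𝓝 (f z)) :=
      hf.continuousWithinAt.mono_left (nhdsWithin_mono _ Ioo_subset_Icc_self)
    have h2 := ((cts (hη.hasDeriv_snd z hz)).mul (cts (h.hasDeriv_fst z hz).ofReal_comp)).sub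
      ((cts (h.hasDeriv_snd z hz).ofReal_comp).mul (cts (hη.hasDeriv_fst z hz)))
    have h3 := h2.mul h1
    rw [huz, hηz, Complex.ofReal_zero, mul_zero, mul_zero, sub_zero, zero_mul] at h3
    refine h3.congr fun x => ?_
    simp [hZ]
  have h0L : 0 < L := hx₀'.1.trans hx₀'.2
  have hZ0 := hlim 0 ⟨le_rfl, h0L.le⟩ (by simp) hu0 hη0 hv0.ne'
  have hZL := hlim L ⟨h0L.le, le_rfl⟩ (by simp) huL hηL hvL.ne
  have hderiv : ∀ x ∈ Ioo 0 L, HasDerivAt Z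
      ((μ₁ - μ) * ((p x * Complex.normSq (η x) : ℝ) : ℂ) + (W x : ℂ)) x := by
    intro x hx
    have hnhds := Icc_mem_nhds hx.1 hx.2
    have hx' := Ioo_subset_Icc_self hx
    have du := (h.hasDerivAt_fst hx).ofReal_comp
    have dv := (h.hasDerivAt_snd hx).ofReal_comp
    have dη := (hη.hasDeriv_fst x hx').hasDerivAt hnhds
    have dV := (hη.hasDeriv_snd x hx').hasDerivAt hnhds
    have hux : (u x : ℂ) ≠ 0 := Complex.ofReal_ne_zero.2 (hu x hx).ne'
    have hpx : (p x : ℂ) ≠ 0 := Complex.ofReal_ne_zero.2 (hpos x).ne'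
    have dc : HasDerivAt (fun x => starRingEnd ℂ (η x)) (starRingEnd ℂ (V x / p x)) x :=
      (Complex.conjCLE.toContinuousLinearMap.hasFDerivAt).comp_hasDerivAt x dη
    convert! ((dV.mul du).sub (dv.mul dη)).mul (dc.div du hux) using 1
    simp only [hW, Complex.ofReal_mul, Complex.ofReal_div, Complex.ofReal_pow,
      Complex.normSq_eq_conj_mul_self, map_sub, map_mul, map_div₀, Complex.conj_ofReal,
      Complex.ofReal_neg, Pi.mul_apply, Pi.sub_apply, Pi.div_apply]
    field_simp
    ring
  have hre : ∀ x ∈ Ioo 0 L, HasDerivAt (fun x => (Z x).re)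
      ((μ₁ - μ.re) * (p x * Complex.normSq (η x)) + W x) x := by
    intro x hx
    convert! (Complex.reCLM.hasFDerivAt).comp_hasDerivAt x (hderiv x hx) using 1
    simp
  have him : ∀ x ∈ Ioo 0 L, HasDerivAt (fun x => (Z x).im)
      (-μ.im * (p x * Complex.normSq (η x))) x := by
    intro x hx
    convert! (Complex.imCLM.hasFDerivAt).comp_hasDerivAt x (hderiv x hx) using 1
    simp
  have hn : ∀ x, 0 ≤ p x * Complex.normSq (η x) := fun x =>
    mul_nonneg (hpos x).le (Complex.normSq_nonneg _)
  have hn₀ : 0 < p x₀ * Complex.normSq (η x₀) :=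
    mul_pos (hpos x₀) (Complex.normSq_pos.2 hηx₀)
  have tre {z : ℝ} (hz : Tendsto Z (𝓝[Ioo 0 L] z) (𝓝 0)) :
      Tendsto (fun x => (Z x).re) (𝓝[Ioo 0 L] z) (𝓝 0) :=
    (Complex.continuous_re.tendsto 0).comp hz
  have tim {z : ℝ} (hz : Tendsto Z (𝓝[Ioo 0 L] z) (𝓝 0)) :
      Tendsto (fun x => (Z x).im) (𝓝[Ioo 0 L] z) (𝓝 0) :=
    (Complex.continuous_im.tendsto 0).comp hz
  have hWn : ∀ x, 0 ≤ W x := fun x =>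
    div_nonneg (Complex.normSq_nonneg _) (mul_nonneg (hpos x).le (sq_nonneg _))
  constructor
  · rcases le_total μ.im 0 with hle | hle
    · have := deriv_eq_zero_of_tendsto_zero him
        (fun x _ => mul_nonneg (by linarith) (hn x)) (tim hZ0) (tim hZL) x₀ hx₀'
      rcases mul_eq_zero.1 this with h | h
      · linarith
      · exact absurd h hn₀.ne'
    · have := deriv_eq_zero_of_tendsto_zero (f := fun x => -(Z x).im)
        (fun x hx => (him x hx).fun_neg)
        (fun x _ => by rw [neg_mul, neg_neg]; exact mul_nonneg hle (hn x))
        (by simpa using (tim hZ0).neg) (by simpa using (tim hZL).neg) x₀ hx₀'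
      rw [neg_mul, neg_neg] at this
      exact (mul_eq_zero.1 this).resolve_right hn₀.ne'
  · by_contra! hlt
    have := deriv_eq_zero_of_tendsto_zero hre
        (fun x _ => add_nonneg (mul_nonneg (by linarith) (hn x)) (hWn x)) (tre hZ0) (tre hZL)
        x₀ hx₀'
    have h1 : 0 < (μ₁ - μ.re) * (p x₀ * Complex.normSq (η x₀)) := mul_pos (by linarith) hn₀
    linarith [hWn x₀]

/-! ### Passage between H² solutions and the first-order system -/

section

lemma Admissible.ae_abs_le {κ : ℝ → ℝ} (h : Admissible κ) : ∀ᵐ x ∂domMeasure, |κ x| ≤ 1 := by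
  filter_upwards [ae_le_eLpNormEssSup (f := κ) (μ := domMeasure)] with x hx
  have h1 := h.norm_eq
  rw [eLpNorm_exponent_top] at h1
  rw [h1, ← enorm_one (G := ℝ), enorm_le_iff_norm_le] at hx
  simpa using hx

/-- Extension by zero puts the profile on the whole line, where the weight and flux lemmas ask for
an a.e. bound and local integrability. -/
lemma Admissible.ae_abs_indicator_le {κ : ℝ → ℝ} (h : Admissible κ) :
    ∀ᵐ x, |dom.indicator κ x| ≤ 1 := by
  have := (ae_restrict_iff' (μ := volume) (s := dom) measurableSet_Icc).1 h.ae_abs_le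
  filter_upwards [this] with x hx
  by_cases hxd : x ∈ dom
  · rw [indicator_of_mem hxd]
    exact hx hxd
  · simp [indicator_of_notMem hxd]

lemma Admissible.locallyIntegrable_indicator {κ : ℝ → ℝ} (h : Admissible κ) :
    LocallyIntegrable (dom.indicator κ) :=
  locallyIntegrable_of_ae_abs_le
    ((aestronglyMeasurable_indicator_iff measurableSet_Icc).2 h.memLp.aestronglyMeasurable)
    h.ae_abs_indicator_le

section transfer

variable {c : ℝ} {κ : ℝ → ℝ}

lemma intervalIntegrable_of_memLp_two {f : ℝ → ℂ} (hf : MemLp f 2 domMeasure) :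
    IntervalIntegrable f volume 0 (2 * Real.pi) := by
  have : IsFiniteMeasure domMeasure := by
    unfold domMeasure dom
    infer_instance
  have h : IntegrableOn f dom := hf.integrable (by norm_num)
  rw [intervalIntegrable_iff_integrableOn_Icc_of_le (by positivity)]
  exact h

/-- The product pη₁ is absolutely continuous with a.e. derivative p(η₂ + cκη₁) = -μpη. The right
side is continuous, so pη₁ is in fact C¹. The functional ℓ stands for the real or imaginary part,
reducing to real-valued absolute continuity. -/
lemma weighted_deriv_eq_integral (hk : LocallyIntegrable (dom.indicator κ)) {μ : ℂ}
    {η η₁ η₂ : ℝ → ℂ} (h : IsH2 η η₁ η₂)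
    (heq : ∀ᵐ x ∂domMeasure, η₂ x + c * κ x * η₁ x = -(μ * η x)) (ℓ : ℂ →L[ℝ] ℝ) {x : ℝ}
    (hx : x ∈ dom) :
    weight c (dom.indicator κ) x * ℓ (η₁ x) = ℓ (η₁ 0)
      + ∫ t in (0 : ℝ)..x, ℓ (-(μ * weight c (dom.indicator κ) t * η t)) := by
  set p := weight c (dom.indicator κ) with hp
  have hint := intervalIntegrable_of_memLp_two h.memLp
  have hsub : ∀ y ∈ dom, uIcc 0 y ⊆ uIcc 0 (2 * Real.pi) := fun y hy => by
    rw [uIcc_of_le hy.1, uIcc_of_le (hy.1.trans hy.2)]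
    exact Icc_subset_Icc_right hy.2
  have hℓ : IntervalIntegrable (fun t => ℓ (η₂ t)) volume 0 x :=
    let hi := hint.mono_set (hsub x hx)
    ⟨ℓ.integrable_comp hi.1, ℓ.integrable_comp hi.2⟩
  have hprim : ∀ y ∈ dom, ℓ (η₁ y) = ℓ (η₁ 0) + ∫ t in (0 : ℝ)..y, ℓ (η₂ t) := fun y hy => by
    rw [ℓ.intervalIntegral_comp_comm (hint.mono_set (hsub y hy)), ← map_add, ← h.primitive y hy]
  set q : ℝ → ℝ := fun y => ℓ (η₁ 0) + ∫ t in (0 : ℝ)..y, ℓ (η₂ t) with hq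
  have hqac : AbsolutelyContinuousOnInterval q 0 x :=
    (ContDiffOn.absolutelyContinuousOnInterval (contDiffOn_const (c := ℓ (η₁ 0)))).fun_add
      (hℓ.absolutelyContinuousOnInterval_intervalIntegral left_mem_uIcc)
  have key := eq_add_integral_of_ae_hasDerivAt
    (f' := fun t => ℓ (-(μ * p t * η t)))
    ((absolutelyContinuous_weight (c := c) hk 0 x).fun_mul hqac) ?_
  · rw [← hp] at key
    rw [hprim x hx, key]
    simp [hq, hp, weight_zero]
  · have heq' := (ae_restrict_iff' (μ := volume) (s := dom) measurableSet_Icc).1 heq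
    filter_upwards [heq', ae_hasDerivAt_weight (c := c) hk, hℓ.ae_hasDerivAt_integral]
      with t ht hw hi htx
    have htd : t ∈ dom := by
      rw [uIcc_of_le hx.1] at htx
      exact ⟨htx.1, htx.2.trans hx.2⟩
    have hqd : HasDerivAt q (ℓ (η₂ t)) t := (hi htx 0 left_mem_uIcc).const_add _
    convert! hw.mul hqd using 1
    have hqt : q t = ℓ (η₁ t) := (hprim t htd).symm
    rw [hqt, ← hp, indicator_of_mem htd]
    have e1 : -(μ * p t * η t) = (p t) • (η₂ t) + (c * κ t * p t) • (η₁ t) := by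
      have := ht htd
      simp only [Complex.real_smul]
      push_cast
      linear_combination (-(p t : ℂ)) * this
    rw [e1, map_add, map_smul, map_smul, smul_eq_mul, smul_eq_mul]
    ring

/-- A strong solution in `H²` gives a classical solution of the first-order system. -/
lemma IsH2.slPairC (hk : LocallyIntegrable (dom.indicator κ)) {μ : ℂ}
    {η η₁ η₂ : ℝ → ℂ} (h : IsH2 η η₁ η₂)
    (heq : ∀ᵐ x ∂domMeasure, η₂ x + c * κ x * η₁ x = -(μ * η x)) :
    SLPairC (weight c (dom.indicator κ)) (2 * Real.pi) μ η
      (fun x => weight c (dom.indicator κ) x * η₁ x) := by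
  set p := weight c (dom.indicator κ) with hp
  have hpc : Continuous p := continuous_weight hk
  have hηc : ContinuousOn η dom := fun x hx => (h.hasDeriv x hx).continuousWithinAt
  have hfc : ContinuousOn (fun t => -(μ * p t * η t)) dom :=
    ((continuousOn_const.mul (Complex.continuous_ofReal.comp hpc).continuousOn).mul hηc).neg
  have hfi : ∀ x ∈ dom, IntervalIntegrable (fun t => -(μ * p t * η t)) volume 0 x := by
    intro x hx
    refine (hfc.mono ?_).intervalIntegrable
    rw [uIcc_of_le hx.1]
    exact Icc_subset_Icc_right hx.2
  refine ⟨fun x hx => ?_, fun x hx => ?_⟩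
  · have : (p x : ℂ) ≠ 0 := Complex.ofReal_ne_zero.2 (weight_pos x).ne'
    rw [mul_div_cancel_left₀ _ this]
    exact h.hasDeriv x hx
  · have hV : ∀ y ∈ dom, (p y : ℂ) * η₁ y = η₁ 0 + ∫ t in (0 : ℝ)..y, -(μ * p t * η t) := by
      intro y hy
      apply Complex.ext
      · have := weighted_deriv_eq_integral hk h heq Complex.reCLM hy
        rw [Complex.reCLM.intervalIntegral_comp_comm (hfi y hy)] at this
        simpa using this
      · have := weighted_deriv_eq_integral hk h heq Complex.imCLM hy
        rw [Complex.imCLM.intervalIntegral_comp_comm (hfi y hy)] at this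
        simpa using this
    have : Fact (x ∈ Icc 0 (2 * Real.pi)) := ⟨hx⟩
    have h1 : HasDerivWithinAt (fun y => ∫ t in (0 : ℝ)..y, -(μ * p t * η t))
        (-(μ * p x * η x)) (Icc 0 (2 * Real.pi)) x :=
      intervalIntegral.integral_hasDerivWithinAt_right (hfi x hx)
        (hfc.stronglyMeasurableAtFilter_nhdsWithin measurableSet_Icc x) (hfc x hx)
    exact (h1.const_add (η₁ 0)).congr hV (hV x hx)

/-- A real classical solution of the first-order system gives an `H²` solution. -/
lemma SLPair.isH2 (hκ : Admissible κ) {μ : ℝ} {u v : ℝ → ℝ}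
    (h : SLPair (weight c (dom.indicator κ)) (2 * Real.pi) μ u v) :
    IsH2 (fun x => (u x : ℂ)) (fun x => ((v x * weight (-c) (dom.indicator κ) x : ℝ) : ℂ))
      (fun x => ((-(c * κ x * (v x * weight (-c) (dom.indicator κ) x)) - μ * u x : ℝ) : ℂ)) := by
  have hk := hκ.locallyIntegrable_indicator
  -- Writing 1/p as the weight for -c makes v/p a product of absolutely continuous functions;
  -- differentiating it gives back the second derivative prescribed by the equation.
  set p := weight c (dom.indicator κ) with hp
  set p' := weight (-c) (dom.indicator κ) with hp'
  have hinv : ∀ x, p' x = (p x)⁻¹ := fun x => by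
    rw [hp, hp', weight, weight, neg_mul, Real.exp_neg]
  have hp0 : ∀ x, p x ≠ 0 := fun x => (weight_pos x).ne'
  have hpc : Continuous p := continuous_weight hk
  have hpc' : Continuous p' := continuous_weight hk
  have huc : ContinuousOn u dom := h.continuousOn_fst
  have hvc : ContinuousOn v dom := h.continuousOn_snd
  have hwc : ContinuousOn (fun x => v x * p' x) dom := hvc.mul hpc'.continuousOn
  refine ⟨fun x hx => ?_, ?_, fun x hx => ?_⟩
  · have := (h.hasDeriv_fst x hx).ofReal_comp
    rw [hinv, ← div_eq_mul_inv]
    exact this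
  · have : IsFiniteMeasure domMeasure := by
      unfold domMeasure dom
      infer_instance
    obtain ⟨B₁, hB₁⟩ := (isCompact_Icc : IsCompact dom).exists_bound_of_continuousOn hwc
    obtain ⟨B₂, hB₂⟩ := (isCompact_Icc : IsCompact dom).exists_bound_of_continuousOn huc
    refine MemLp.of_bound (C := |c| * B₁ + |μ| * B₂) ?_ ?_
    · refine Complex.continuous_ofReal.comp_aestronglyMeasurable ?_
      refine ((hκ.memLp.aestronglyMeasurable.const_mul c).mul
        (hwc.aestronglyMeasurable measurableSet_Icc)).neg.sub
        ((huc.aestronglyMeasurable measurableSet_Icc).const_mul μ)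
    · have hmem : ∀ᵐ x ∂domMeasure, x ∈ dom := ae_restrict_mem measurableSet_Icc
      filter_upwards [hκ.ae_abs_le, hmem] with x hx hxd
      rw [Complex.norm_real]
      refine (norm_sub_le _ _).trans (add_le_add ?_ ?_)
      · rw [norm_neg, norm_mul, norm_mul, Real.norm_eq_abs, Real.norm_eq_abs]
        refine mul_le_mul ?_ (hB₁ x hxd) (norm_nonneg _) (abs_nonneg _)
        exact mul_le_of_le_one_right (abs_nonneg _) hx
      · rw [norm_mul, Real.norm_eq_abs]
        exact mul_le_mul_of_nonneg_left (hB₂ x hxd) (abs_nonneg _)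
  · rw [intervalIntegral.integral_ofReal, ← Complex.ofReal_add]
    congr 1
    have hsub : Icc 0 x ⊆ Icc 0 (2 * Real.pi) := Icc_subset_Icc_right hx.2
    have hvac : AbsolutelyContinuousOnInterval v 0 x :=
      absolutelyContinuous_of_hasDerivWithinAt hx.1
        (fun y hy => (h.hasDeriv_snd y (hsub hy)).mono hsub)
        (((continuousOn_const.mul hpc.continuousOn).mul (huc.mono hsub)).neg)
    refine eq_add_integral_of_ae_hasDerivAt
      (hvac.fun_mul (absolutelyContinuous_weight hk 0 x)) ?_
    filter_upwards [ae_hasDerivAt_weight (c := -c) hk, Measure.ae_ne volume 0,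
      Measure.ae_ne volume (2 * Real.pi)] with t hw ht0 htL ht
    rw [uIcc_of_le hx.1] at ht
    have htd := hsub ht
    have ht' : t ∈ Ioo 0 (2 * Real.pi) :=
      ⟨lt_of_le_of_ne htd.1 (Ne.symm ht0), lt_of_le_of_ne htd.2 htL⟩
    convert! (h.hasDerivAt_snd ht').mul hw using 1
    rw [indicator_of_mem (show t ∈ dom from htd), ← hp', hinv]
    have := hp0 t
    field_simp
    ring

end transfer

/-! ### Spectrum of the mistuned platoon -/

variable {k₀ b₀ ε : ℝ} {N : ℕ} {κ : ℝ → ℝ}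

/-- The coefficient of the first-order term after division by `a₀²`. -/
noncomputable def drift (k₀ : ℝ) (N : ℕ) (ε : ℝ) : ℝ := ε * N / (Real.pi * k₀)

lemma eigen_equation_iff (hk₀ : 0 < k₀) (hN : 0 < N) (K : ℝ) (w μ e e₁ e₂ : ℂ)
    (hμ : w = -((k₀ / rho N ^ 2 : ℝ) : ℂ) * μ) :
    w * e = ((k₀ / rho N ^ 2 : ℝ) : ℂ) * e₂ + ε * ((((K - -K) / rho N : ℝ) : ℂ) * e₁
        + (((K + -K) / (2 * rho N ^ 2) : ℝ) : ℂ) * e₂)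
      ↔ e₂ + drift k₀ N ε * K * e₁ = -(μ * e) := by
  have hN' : (N : ℂ) ≠ 0 := by exact_mod_cast hN.ne'
  have hk' : (k₀ : ℂ) ≠ 0 := by exact_mod_cast hk₀.ne'
  have hpi : (Real.pi : ℂ) ≠ 0 := by exact_mod_cast Real.pi_ne_zero
  have h1 : ((k₀ / rho N ^ 2 : ℝ) : ℂ) * e₂ + ε * ((((K - -K) / rho N : ℝ) : ℂ) * e₁
        + (((K + -K) / (2 * rho N ^ 2) : ℝ) : ℂ) * e₂)
      = ((k₀ / rho N ^ 2 : ℝ) : ℂ) * (e₂ + drift k₀ N ε * K * e₁) := by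
    simp only [rho, drift]
    push_cast
    field_simp
    ring
  have h2 : ((k₀ / rho N ^ 2 : ℝ) : ℂ) ≠ 0 := by
    have hr : 0 < rho N := by
      unfold rho
      positivity
    exact_mod_cast (by positivity : k₀ / rho N ^ 2 ≠ 0)
  rw [h1, hμ, mul_assoc, neg_mul, ← mul_neg]
  constructor
  · exact fun h => (mul_left_cancel₀ h2 h).symm
  · exact fun h => by rw [h]

/-- The spectral description of the mistuned platoon: all eigenvalues come from real numbers
`m ≥ μ`, and `μ` itself occurs and satisfies the second-order bound. -/
theorem exists_principal_spectrum (hk₀ : 0 < k₀) (b₀ : ℝ) (hN : 0 < N) (ε : ℝ)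
    (hκ : Admissible κ) :
    ∃ μ : ℝ, |μ - 1 / 4 - drift k₀ N ε * firstVariation (dom.indicator κ)|
        ≤ 9 * drift k₀ N ε ^ 2 ∧
      (0 ≤ ε → κ = bangBang → 1 / 4 + drift k₀ N ε ^ 2 / 4 ≤ μ) ∧
      (∀ s : ℂ, s ^ 2 + b₀ * s = ((-(k₀ / rho N ^ 2 * μ) : ℝ) : ℂ) →
        s ∈ eigenvalues k₀ b₀ N ε κ (fun x => -κ x)) ∧
      ∀ s ∈ eigenvalues k₀ b₀ N ε κ (fun x => -κ x), ∃ m : ℝ, μ ≤ m ∧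
        s ^ 2 + b₀ * s = ((-(k₀ / rho N ^ 2 * m) : ℝ) : ℂ) := by
  have hk := hκ.locallyIntegrable_indicator
  have hb := hκ.ae_abs_indicator_le
  set c := drift k₀ N ε with hc
  obtain ⟨μ, u, v, h, hu0, huL, hu, hv0, hvL, hμ⟩ := exists_principal_slPair_weight hk hb c
  have hpi := Real.pi_pos
  refine ⟨μ, hμ, ?_, fun s hs => ?_, ?_⟩
  · rintro hε rfl
    exact le_principal_bangBang (by rw [hc, drift]; positivity) h hu0 huL hu
  · refine ⟨_, _, _, h.isH2 hκ, by simp [hu0], by simp [huL], ⟨Real.pi, ?_, ?_⟩, ?_⟩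
    · exact ⟨hpi.le, by linarith⟩
    · exact Complex.ofReal_ne_zero.2 (hu _ ⟨hpi, by linarith⟩).ne'
    · refine Eventually.of_forall fun x => ?_
      rw [eigen_equation_iff hk₀ hN (κ x) _ μ _ _ _ (by rw [hs]; push_cast; ring), ← hc]
      push_cast
      ring
  · rintro s ⟨η, η₁, η₂, hH, hη0, hηL, hne, heq⟩
    have hr : 0 < rho N := by
      unfold rho
      positivity
    have h2 : ((k₀ / rho N ^ 2 : ℝ) : ℂ) ≠ 0 := by
      exact_mod_cast (by positivity : k₀ / rho N ^ 2 ≠ 0)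
    -- Any s determines a spectral parameter ν, a priori complex; the Picone argument shows that it
    -- is real and at least μ.
    set ν : ℂ := -(s ^ 2 + b₀ * s) / ((k₀ / rho N ^ 2 : ℝ) : ℂ) with hν
    have hsν : s ^ 2 + b₀ * s = -((k₀ / rho N ^ 2 : ℝ) : ℂ) * ν := by
      rw [hν]
      field_simp
    have hpair := hH.slPairC (c := c) (μ := ν) hk (by
      filter_upwards [heq] with x hx
      exact (eigen_equation_iff hk₀ hN (κ x) _ ν _ _ _ hsν).1 hx)
    obtain ⟨him, hre⟩ := real_and_ge_of_slPairC (fun x => weight_pos x) h hu0 huL hu hv0 hvL hpair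
      hη0 hηL hne
    refine ⟨ν.re, hre, ?_⟩
    have : ((ν.re : ℝ) : ℂ) = ν := Complex.ext (by simp) (by simp [him])
    rw [hsν]
    push_cast
    rw [this]
    ring

end

/-! ### Optimality of the bang-bang profile -/

lemma domMeasure_univ : domMeasure univ = ENNReal.ofReal (2 * Real.pi) := by
  simp [domMeasure, dom]

lemma admissible_bangBang : Admissible bangBang := by
  have h2pi : (0 : ℝ) < 2 * Real.pi := by positivity
  have hfin : IsFiniteMeasure domMeasure := ⟨by rw [domMeasure_univ]; exact ENNReal.ofReal_lt_top⟩
  have hne : domMeasure ≠ 0 := by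
    rw [← Measure.measure_univ_ne_zero, domMeasure_univ]
    simpa using h2pi
  refine ⟨?_, ?_, ?_⟩
  · exact MemLp.of_bound (C := 1) measurable_bangBang.aestronglyMeasurable
      (Eventually.of_forall fun x => by rw [Real.norm_eq_abs, abs_bangBang])
  · rw [eLpNorm_congr_norm_ae (g := fun _ => (1 : ℝ))
      (Eventually.of_forall fun x => by simp [abs_bangBang])]
    simp [eLpNorm_exponent_top, eLpNormEssSup_const, hne]
  · have hset : {a : ℝ | ∀ᵐ x ∂domMeasure, bangBang x ≤ a} = Ici 1 := by
      ext a
      refine ⟨fun h => ?_, fun h => ?_⟩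
      swap
      · have h1 (x : ℝ) : bangBang x ≤ a := ((le_abs_self _).trans_eq (abs_bangBang x)).trans h
        rw [mem_ofPred_eq]
        exact Eventually.of_forall h1
      by_contra hlt
      rw [mem_Ici, not_le] at hlt
      have h0 : domMeasure (Ioc Real.pi (2 * Real.pi)) = 0 := by
        refine measure_mono_null (fun x hx => ?_) (ae_iff.1 h)
        simpa [bangBang_of_le hx.1.le] using hlt
      have hsub : Ioc Real.pi (2 * Real.pi) ⊆ dom := fun x hx =>
        ⟨Real.pi_pos.le.trans hx.1.le, hx.2⟩
      rw [domMeasure, Measure.restrict_eq_self _ hsub, Real.volume_Ioc] at h0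
      simp only [ENNReal.ofReal_eq_zero] at h0
      linarith [Real.pi_pos]
    rw [essSup, limsup_eq, hset, csInf_Ici]

lemma firstVariation_indicator (κ : ℝ → ℝ) :
    firstVariation (dom.indicator κ)
      = -(1 / (4 * Real.pi)) * ∫ x, κ x * Real.sin x ∂domMeasure := by
  rw [firstVariation, intervalIntegral.integral_of_le (by positivity),
    ← integral_Icc_eq_integral_Ioc, domMeasure]
  congr 1
  refine setIntegral_congr_fun measurableSet_Icc fun x hx => ?_
  simp only [indicator_of_mem (show x ∈ dom from hx)]

lemma firstVariation_bangBang : firstVariation (dom.indicator bangBang) = 1 / Real.pi := by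
  have hi (a b : ℝ) :
      IntervalIntegrable (fun t => dom.indicator bangBang t * Real.sin t) volume a b :=
    (intervalIntegrable_of_locallyIntegrable locallyIntegrable_indicator_bangBang a b).mul_continuousOn
      (by fun_prop)
  have hpi := Real.pi_pos
  have h1 : ∫ t in (0 : ℝ)..Real.pi, dom.indicator bangBang t * Real.sin t
      = ∫ t in (0 : ℝ)..Real.pi, -Real.sin t := by
    refine intervalIntegral.integral_congr_ae ?_
    filter_upwards [Measure.ae_ne volume Real.pi] with t ht htm
    rw [uIoc_of_le hpi.le] at htm
    rw [indicator_of_mem (show t ∈ dom from ⟨htm.1.le, by linarith [htm.2]⟩),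
      bangBang_of_lt (lt_of_le_of_ne htm.2 ht)]
    ring
  have h2 : ∫ t in Real.pi..(2 * Real.pi), dom.indicator bangBang t * Real.sin t
      = ∫ t in Real.pi..(2 * Real.pi), Real.sin t := by
    refine intervalIntegral.integral_congr fun t ht => ?_
    rw [uIcc_of_le (by linarith)] at ht
    rw [indicator_of_mem (show t ∈ dom from ⟨by linarith [ht.1], ht.2⟩), bangBang_of_le ht.1,
      one_mul]
  rw [firstVariation, ← intervalIntegral.integral_add_adjacent_intervals (hi 0 Real.pi)
    (hi Real.pi _), h1, h2, intervalIntegral.integral_neg, integral_sin, integral_sin]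
  simp
  field_simp
  norm_num

/-- Off the zeros of sine the profile is -sgn(sin x), so it minimizes κ(x) sin x pointwise under
|κ(x)| ≤ 1. -/
lemma sub_bangBang_mul_sin_nonneg {κ : ℝ → ℝ} {x : ℝ} (hx : x ∈ dom) (hκ : |κ x| ≤ 1) :
    0 ≤ (κ x - bangBang x) * Real.sin x := by
  rw [abs_le] at hκ
  rcases lt_or_ge x Real.pi with h | h
  · rw [bangBang_of_lt h]
    exact mul_nonneg (by linarith) (Real.sin_nonneg_of_nonneg_of_le_pi hx.1 h.le)
  · rw [bangBang_of_le h]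
    refine mul_nonneg_of_nonpos_of_nonpos (by linarith) ?_
    rw [← Real.sin_sub_two_pi]
    exact Real.sin_nonpos_of_nonpos_of_neg_pi_le (by linarith [hx.2]) (by linarith)

/-- The bang-bang profile is the unique maximizer of the first variation. -/
lemma firstVariation_le_and_eq_iff {κ : ℝ → ℝ} (hκ : Admissible κ) :
    firstVariation (dom.indicator κ) ≤ firstVariation (dom.indicator bangBang) ∧
    (firstVariation (dom.indicator κ) = firstVariation (dom.indicator bangBang) ↔
      κ =ᵐ[domMeasure] bangBang) := by
  have hfin : IsFiniteMeasure domMeasure := ⟨by rw [domMeasure_univ]; exact ENNReal.ofReal_lt_top⟩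
  have hi {f : ℝ → ℝ} (hf : Admissible f) :
      Integrable (fun x => f x * Real.sin x) domMeasure := by
    refine (hf.memLp.integrable (by simp)).mul_bdd (c := 1)
      Real.continuous_sin.aestronglyMeasurable (Eventually.of_forall fun x => ?_)
    exact Real.abs_sin_le_one x
  have hmem : ∀ᵐ x ∂domMeasure, x ∈ dom := ae_restrict_mem measurableSet_Icc
  have hnn : 0 ≤ᵐ[domMeasure] fun x => (κ x - bangBang x) * Real.sin x := by
    filter_upwards [hmem, hκ.ae_abs_le] with x hx hκx using sub_bangBang_mul_sin_nonneg hx hκx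
  have hsub : ∫ x, (κ x - bangBang x) * Real.sin x ∂domMeasure
      = (∫ x, κ x * Real.sin x ∂domMeasure) - ∫ x, bangBang x * Real.sin x ∂domMeasure := by
    rw [← integral_sub (hi hκ) (hi admissible_bangBang)]
    simp only [sub_mul]
  have hdi : Integrable (fun x => (κ x - bangBang x) * Real.sin x) domMeasure := by
    simp only [sub_mul]
    exact (hi hκ).sub (hi admissible_bangBang)
  have h0 := integral_nonneg_of_ae hnn
  have hpi : 0 < 1 / (4 * Real.pi) := by positivity
  rw [firstVariation_indicator, firstVariation_indicator]
  refine ⟨?_, ?_⟩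
  · rw [neg_mul, neg_mul, neg_le_neg_iff]
    exact mul_le_mul_of_nonneg_left (by linarith) hpi.le
  · rw [mul_right_inj' (neg_ne_zero.2 hpi.ne'), ← sub_eq_zero, ← hsub,
      integral_eq_zero_iff_of_nonneg_ae hnn hdi]
    -- Sine vanishes only at 0, π and 2π on the domain, so a vanishing integrand forces equality of
    -- the profiles almost everywhere.
    have hsin : ∀ᵐ x ∂domMeasure, Real.sin x ≠ 0 := by
      have h1 (a : ℝ) : ∀ᵐ x ∂domMeasure, x ≠ a := ae_restrict_of_ae (Measure.ae_ne volume a)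
      filter_upwards [hmem, h1 0, h1 Real.pi, h1 (2 * Real.pi)] with x hx hx0 hxpi hx2 hs
      rcases lt_or_gt_of_ne hxpi with h | h
      · exact (Real.sin_pos_of_pos_of_lt_pi (lt_of_le_of_ne hx.1 (Ne.symm hx0)) h).ne' hs
      · rw [← Real.sin_sub_two_pi] at hs
        have hlt := lt_of_le_of_ne hx.2 hx2
        exact (Real.sin_neg_of_neg_of_neg_pi_lt (by linarith) (by linarith)).ne hs
    constructor
    · intro h
      filter_upwards [h, hsin] with x hx hs
      exact sub_eq_zero.1 ((mul_eq_zero.1 hx).resolve_right hs)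
    · intro h
      filter_upwards [h] with x hx
      simp [hx]

/-! ### From the principal level to the least stable eigenvalue -/

/-- The least stable root of `s² + b₀ s + y = 0`. -/
noncomputable def stableRoot (b₀ y : ℝ) : ℝ := (-b₀ + √(b₀ ^ 2 - 4 * y)) / 2

/-- A root of s² + b₀s = -m is either real or has real part -b₀/2. The stable root exceeds -b₀/2
strictly, and a real root beyond it would need m < y. -/
lemma isLeastStable_stableRoot {b₀ y : ℝ} (hy : 4 * y < b₀ ^ 2) {S : Set ℂ}
    (hmem : ∀ s : ℂ, s ^ 2 + b₀ * s = ((-y : ℝ) : ℂ) → s ∈ S)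
    (hS : ∀ s ∈ S, ∃ m : ℝ, y ≤ m ∧ s ^ 2 + b₀ * s = ((-m : ℝ) : ℂ)) :
    IsLeastStable S (stableRoot b₀ y : ℂ) := by
  set f := stableRoot b₀ y with hf
  have hsq : √(b₀ ^ 2 - 4 * y) ^ 2 = b₀ ^ 2 - 4 * y := Real.sq_sqrt (by linarith)
  have hpos : 0 < √(b₀ ^ 2 - 4 * y) := Real.sqrt_pos.2 (by linarith)
  have hf2 : 2 * f + b₀ = √(b₀ ^ 2 - 4 * y) := by
    rw [hf, stableRoot]
    ring
  have hroot : f ^ 2 + b₀ * f = -y := by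
    rw [← hf2] at hsq
    linarith
  refine ⟨hmem _ (by exact_mod_cast hroot), fun z hz hne => ?_⟩
  obtain ⟨m, hm, hzm⟩ := hS z hz
  have hre := congrArg Complex.re hzm
  have him := congrArg Complex.im hzm
  simp only [pow_two, Complex.add_re, Complex.mul_re, Complex.ofReal_re, Complex.ofReal_im,
    Complex.add_im, Complex.mul_im, zero_mul, sub_zero, add_zero] at hre him
  rw [Complex.ofReal_re]
  have him' : z.im * (2 * z.re + b₀) = 0 := by linarith
  rcases mul_eq_zero.1 him' with h | h
  · by_contra! hge
    refine hne (Complex.ext ?_ (by simpa using h))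
    rw [Complex.ofReal_re]
    refine le_antisymm ?_ hge
    rw [h] at hre
    have h1 : (z.re - f) * (z.re + f + b₀) ≤ 0 := by nlinarith
    by_contra! hlt
    exact absurd h1 (not_le.2 (mul_pos (by linarith) (by linarith)))
  · linarith

lemma sOne_eq_of_isLeastStable {k₀ b₀ ε : ℝ} {N : ℕ} {κ : ℝ → ℝ} {x : ℝ}
    (h : IsLeastStable (eigenvalues k₀ b₀ N ε κ (fun x => -κ x)) (x : ℂ)) :
    sOne k₀ b₀ N ε κ = x := by
  refine IsGreatest.csSup_eq ⟨⟨_, h.1, Complex.ofReal_re x⟩, ?_⟩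
  rintro _ ⟨z, hz, rfl⟩
  by_cases hzx : z = x
  · rw [hzx, Complex.ofReal_re]
  · exact (h.2 z hz hzx).le

section

/-- Second-order Taylor bound for y ↦ (-b₀ + √(b₀² - 4y))/2, with derivative -1/S₀ at y₀, through an
exact identity for the remainder. Keeping both square roots above b₀/2 makes the constant depend
only on b₀, A and K. -/
lemma abs_stableRoot_sub_le {b₀ y y₀ S S₀ d A K ε : ℝ} (hb₀ : 0 < b₀)
    (hS : b₀ / 2 ≤ S) (hS₀ : b₀ / 2 ≤ S₀) (hSy : S ^ 2 = b₀ ^ 2 - 4 * y)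
    (hSy₀ : S₀ ^ 2 = b₀ ^ 2 - 4 * y₀) (hd : |y - y₀ - d| ≤ A * ε ^ 2)
    (hy : |y - y₀| ≤ K * ε) :
    |(-b₀ + S) / 2 - (-b₀ + S₀) / 2 - -(d / S₀)| ≤ (2 * A / b₀ + 8 * K ^ 2 / b₀ ^ 3) * ε ^ 2 := by
  have hS' : 0 < S := by linarith
  have hS₀' : 0 < S₀ := by linarith
  have hyS : y - y₀ = (S₀ ^ 2 - S ^ 2) / 4 := by linarith
  have e : (-b₀ + S) / 2 - (-b₀ + S₀) / 2 - -(d / S₀)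
      = -((y - y₀ - d) / S₀) + -(4 * (y - y₀) ^ 2 / (S₀ * (S + S₀) ^ 2)) := by
    have : S + S₀ ≠ 0 := by positivity
    rw [hyS]
    field_simp
    ring
  rw [e]
  refine (abs_add_le _ _).trans ?_
  rw [abs_neg, abs_neg, abs_div, abs_of_pos hS₀', add_mul]
  refine add_le_add ?_ ?_
  · rw [div_le_iff₀ hS₀']
    have h0 : 0 ≤ A * ε ^ 2 := (abs_nonneg _).trans hd
    have h1 : 1 ≤ 2 / b₀ * S₀ := by
      rw [div_mul_eq_mul_div, le_div_iff₀ hb₀]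
      linarith
    calc _ ≤ A * ε ^ 2 * 1 := by linarith
      _ ≤ A * ε ^ 2 * (2 / b₀ * S₀) := mul_le_mul_of_nonneg_left h1 h0
      _ = _ := by ring
  · have hsq : (y - y₀) ^ 2 ≤ K ^ 2 * ε ^ 2 := by
      rw [← mul_pow, ← sq_abs (y - y₀)]
      exact pow_le_pow_left₀ (abs_nonneg _) hy 2
    have hden : b₀ ^ 3 / 2 ≤ S₀ * (S + S₀) ^ 2 := by
      have : b₀ ^ 2 ≤ (S + S₀) ^ 2 := pow_le_pow_left₀ hb₀.le (by linarith) 2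
      calc b₀ ^ 3 / 2 = b₀ / 2 * b₀ ^ 2 := by ring
        _ ≤ _ := mul_le_mul hS₀ this (by positivity) hS₀'.le
    rw [abs_of_nonneg (by positivity)]
    calc 4 * (y - y₀) ^ 2 / (S₀ * (S + S₀) ^ 2) ≤ 4 * (K ^ 2 * ε ^ 2) / (b₀ ^ 3 / 2) := by
          gcongr
      _ = _ := by field_simp; ring

/-- `a₀² / 4`, the value of `-(s² + b₀ s)` at the least stable eigenvalue without mistuning. -/
noncomputable def baseLevel (k₀ : ℝ) (N : ℕ) : ℝ := Real.pi ^ 2 * k₀ / (N : ℝ) ^ 2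

/-- The first-order coefficient of the least stable eigenvalue in `ε`. -/
noncomputable def firstOrder (k₀ b₀ : ℝ) (N : ℕ) (κ : ℝ → ℝ) : ℝ :=
  -(4 * Real.pi / N * firstVariation (dom.indicator κ) / √(b₀ ^ 2 - 4 * baseLevel k₀ N))

variable {k₀ b₀ ε : ℝ} {N : ℕ} {κ : ℝ → ℝ}

lemma baseLevel_nonneg (hk₀ : 0 < k₀) : 0 ≤ baseLevel k₀ N := by
  unfold baseLevel
  positivity

lemma baseLevel_le (hk₀ : 0 < k₀) : baseLevel k₀ N ≤ 16 * k₀ / (N : ℝ) ^ 2 := by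
  unfold baseLevel
  have : Real.pi ^ 2 ≤ 16 := by nlinarith [Real.pi_pos, Real.pi_lt_four]
  gcongr

lemma baseLevel_le_of_large (hk₀ : 0 < k₀) (hN : 0 < N) (hNb : 256 * k₀ ≤ b₀ ^ 2 * N) :
    baseLevel k₀ N ≤ b₀ ^ 2 / 16 := by
  have hN1 : (1 : ℝ) ≤ N := by exact_mod_cast hN
  refine (baseLevel_le hk₀).trans ?_
  rw [div_le_iff₀ (by positivity)]
  have : b₀ ^ 2 * N ≤ b₀ ^ 2 * (N : ℝ) ^ 2 := by
    refine mul_le_mul_of_nonneg_left ?_ (sq_nonneg _)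
    nlinarith
  linarith

/-- The least stable eigenvalue in terms of the principal level `y`. -/
theorem exists_level (hk₀ : 0 < k₀) (hb₀ : 0 < b₀) (hN : 0 < N) (hNb : 256 * k₀ ≤ b₀ ^ 2 * N)
    (hε : 0 ≤ ε) (hε1 : ε ≤ 1) (hεb : (8 + 36 / k₀) * ε ≤ b₀ ^ 2 / 8) (hκ : Admissible κ) :
    ∃ y : ℝ,
      |y - baseLevel k₀ N - ε * (4 * Real.pi / N * firstVariation (dom.indicator κ))|
        ≤ 36 / k₀ * ε ^ 2 ∧
      |y - baseLevel k₀ N| ≤ (8 + 36 / k₀) * ε ∧ y ≤ 3 * b₀ ^ 2 / 16 ∧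
      (κ = bangBang → 4 * ε / N ≤ y) ∧
      IsLeastStable (eigenvalues k₀ b₀ N ε κ (fun x => -κ x)) (sOne k₀ b₀ N ε κ : ℂ) ∧
      sOne k₀ b₀ N ε κ = stableRoot b₀ y := by
  obtain ⟨μ, hμ, hbb, hmem, hS⟩ := exists_principal_spectrum hk₀ b₀ hN ε hκ
  have hN1 : (1 : ℝ) ≤ N := by exact_mod_cast hN
  have hN0 : (0 : ℝ) < N := by linarith
  have hpi := Real.pi_pos
  set m := firstVariation (dom.indicator κ) with hm
  have ha : k₀ / rho N ^ 2 = 4 * baseLevel k₀ N := by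
    unfold rho baseLevel
    field_simp
    ring
  have hy₀ := baseLevel_nonneg (N := N) hk₀
  have hac : 4 * baseLevel k₀ N * drift k₀ N ε = 4 * Real.pi * ε / N := by
    unfold baseLevel drift
    field_simp
  -- Here N cancels: the drift grows like N while a₀² decays like 1/N². With the factor 9 this gives
  -- the uniform constant 36/k₀.
  have hac2 : 4 * baseLevel k₀ N * drift k₀ N ε ^ 2 = 4 / k₀ * ε ^ 2 := by
    unfold baseLevel drift
    field_simp
  set y := k₀ / rho N ^ 2 * μ with hy
  have h1 : |y - baseLevel k₀ N - ε * (4 * Real.pi / N * m)| ≤ 36 / k₀ * ε ^ 2 := by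
    have e : y - baseLevel k₀ N - ε * (4 * Real.pi / N * m)
        = 4 * baseLevel k₀ N * (μ - 1 / 4 - drift k₀ N ε * m) := by
      rw [hy, ha]
      linear_combination m * hac
    rw [e, abs_mul, abs_of_nonneg (by positivity)]
    calc _ ≤ 4 * baseLevel k₀ N * (9 * drift k₀ N ε ^ 2) :=
          mul_le_mul_of_nonneg_left hμ (by positivity)
      _ = 9 * (4 * baseLevel k₀ N * drift k₀ N ε ^ 2) := by ring
      _ = _ := by rw [hac2]; ring
  have h2 : |ε * (4 * Real.pi / N * m)| ≤ 8 * ε := by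
    rw [abs_mul, abs_mul, abs_of_nonneg hε, abs_of_nonneg (by positivity)]
    have hm' := abs_firstVariation_le hκ.ae_abs_indicator_le
    have h3 : 4 * Real.pi / N ≤ 16 := by
      rw [div_le_iff₀ hN0]
      nlinarith [Real.pi_lt_four]
    calc _ ≤ ε * (16 * (1 / 2)) := by gcongr
      _ = _ := by ring
  have h3 : |y - baseLevel k₀ N| ≤ (8 + 36 / k₀) * ε := by
    have h4 : 36 / k₀ * ε ^ 2 ≤ 36 / k₀ * ε := by
      refine mul_le_mul_of_nonneg_left ?_ (by positivity)
      nlinarith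
    have := abs_add_le (y - baseLevel k₀ N - ε * (4 * Real.pi / N * m)) (ε * (4 * Real.pi / N * m))
    rw [sub_add_cancel] at this
    linarith
  -- The sum b₀²/16 + b₀²/8; at this level √(b₀² - 4y) is still at least b₀/2.
  have h4 : y ≤ 3 * b₀ ^ 2 / 16 := by
    have := baseLevel_le_of_large hk₀ hN hNb
    have := (abs_le.1 h3).2
    linarith
  have hls : IsLeastStable (eigenvalues k₀ b₀ N ε κ (fun x => -κ x)) (stableRoot b₀ y : ℂ) := by
    refine isLeastStable_stableRoot (by linarith [pow_pos hb₀ 2]) (fun s hs => hmem s hs) fun s hs => ?_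
    obtain ⟨t, ht, hst⟩ := hS s hs
    exact ⟨_, mul_le_mul_of_nonneg_left ht (by rw [ha]; positivity), hst⟩
  have hs := sOne_eq_of_isLeastStable hls
  refine ⟨y, h1, h3, h4, fun hκb => ?_, by rwa [hs], hs⟩
  have h5 := hbb hε hκb
  -- The chain c/π ≤ c/2 ≤ 1/4 + c²/4, the last step being (c - 1)² ≥ 0.
  have h6 : drift k₀ N ε / Real.pi ≤ μ := by
    have hd : 0 ≤ drift k₀ N ε := by unfold drift; positivity
    have : drift k₀ N ε / Real.pi ≤ drift k₀ N ε / 2 := by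
      have := Real.two_le_pi
      gcongr
    nlinarith [sq_nonneg (drift k₀ N ε - 1)]
  calc 4 * ε / N = 4 * baseLevel k₀ N * (drift k₀ N ε / Real.pi) := by
        rw [← mul_div_assoc, hac]
        field_simp
    _ ≤ 4 * baseLevel k₀ N * μ := mul_le_mul_of_nonneg_left h6 (by positivity)
    _ = y := by rw [hy, ha]

lemma half_le_sqrt {y : ℝ} (hy : y ≤ 3 * b₀ ^ 2 / 16) :
    b₀ / 2 ≤ √(b₀ ^ 2 - 4 * y) := by
  refine Real.le_sqrt_of_sq_le ?_
  linarith

lemma sqrt_sq_sub {y : ℝ} (hy : y ≤ 3 * b₀ ^ 2 / 16) :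
    √(b₀ ^ 2 - 4 * y) ^ 2 = b₀ ^ 2 - 4 * y :=
  Real.sq_sqrt (by nlinarith [sq_nonneg b₀])

/-- The root equals -2y/(b₀ + S) with S ≤ b₀, so it lies below its tangent line at y = 0. -/
lemma stableRoot_le {y : ℝ} (hb₀ : 0 < b₀) (hy0 : 0 ≤ y) (hy : y ≤ 3 * b₀ ^ 2 / 16) :
    stableRoot b₀ y ≤ -(y / b₀) := by
  have h1 := half_le_sqrt hy
  have h2 := sqrt_sq_sub hy
  unfold stableRoot
  set S := √(b₀ ^ 2 - 4 * y)
  have hSb : S ≤ b₀ := by nlinarith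
  have e : (-b₀ + S) / 2 = -(y / ((b₀ + S) / 2)) := by
    have : y = (b₀ ^ 2 - S ^ 2) / 4 := by linarith
    have h0 : b₀ + S ≠ 0 := by positivity
    rw [this]
    field_simp
    ring
  rw [e, neg_le_neg_iff]
  exact div_le_div_of_nonneg_left hy0 (by linarith) (by linarith)

lemma abs_stableRoot_add_le {y : ℝ} (hb₀ : 0 < b₀) (hy0 : 0 ≤ y) (hy : y ≤ 3 * b₀ ^ 2 / 16) :
    |stableRoot b₀ y + y / b₀| ≤ 4 * y ^ 2 / b₀ ^ 3 := by
  have h1 := half_le_sqrt hy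
  have h2 := sqrt_sq_sub hy
  rw [abs_of_nonpos (by linarith [stableRoot_le hb₀ hy0 hy])]
  unfold stableRoot
  set S := √(b₀ ^ 2 - 4 * y)
  have hy' : y = (b₀ ^ 2 - S ^ 2) / 4 := by linarith
  have e : -((-b₀ + S) / 2 + y / b₀) = 4 * y ^ 2 / (b₀ * (b₀ + S) ^ 2) := by
    have h0 : b₀ + S ≠ 0 := by positivity
    rw [hy']
    field_simp
    ring
  rw [e]
  have h3 : b₀ ^ 3 ≤ b₀ * (b₀ + S) ^ 2 := by
    calc b₀ ^ 3 = b₀ * b₀ ^ 2 := by ring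
      _ ≤ _ := mul_le_mul_of_nonneg_left (pow_le_pow_left₀ hb₀.le (by linarith) 2) hb₀.le
  gcongr

lemma abs_stableRoot_le {y : ℝ} (hb₀ : 0 < b₀) (hy0 : 0 ≤ y) (hy : y ≤ 3 * b₀ ^ 2 / 16) :
    |stableRoot b₀ y| ≤ 2 * y / b₀ := by
  have h1 := half_le_sqrt hy
  have h2 := sqrt_sq_sub hy
  have h0 : 0 ≤ y / b₀ := by positivity
  rw [abs_of_nonpos (by linarith [stableRoot_le hb₀ hy0 hy]), le_div_iff₀ hb₀]
  unfold stableRoot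
  nlinarith

lemma firstOrder_bangBang :
    firstOrder k₀ b₀ N bangBang = -(4 / N / √(b₀ ^ 2 - 4 * baseLevel k₀ N)) := by
  have := Real.pi_ne_zero
  rw [firstOrder, firstVariation_bangBang]
  field_simp

lemma abs_firstOrder_bangBang_sub_le (hk₀ : 0 < k₀) (hb₀ : 0 < b₀) (hN : 0 < N)
    (hNb : 256 * k₀ ≤ b₀ ^ 2 * N) :
    |firstOrder k₀ b₀ N bangBang - -4 / (b₀ * N)| ≤ 512 * k₀ / b₀ ^ 3 / (N : ℝ) ^ 2 := by
  have hN1 : (1 : ℝ) ≤ N := by exact_mod_cast hN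
  have hN0 : (0 : ℝ) < N := by linarith
  have hy0 := baseLevel_nonneg (N := N) hk₀
  have hy1 := baseLevel_le_of_large hk₀ hN hNb
  have hy2 := baseLevel_le (N := N) hk₀
  have hy3 : baseLevel k₀ N ≤ 3 * b₀ ^ 2 / 16 := by nlinarith [sq_nonneg b₀]
  have h1 := half_le_sqrt hy3
  have h2 := sqrt_sq_sub hy3
  rw [firstOrder_bangBang]
  set S := √(b₀ ^ 2 - 4 * baseLevel k₀ N)
  have hS : 0 < S := by linarith
  have e : -(4 / N / S) - -4 / (b₀ * N)
      = -(16 * baseLevel k₀ N / (b₀ * S * (b₀ + S) * N)) := by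
    have hy : baseLevel k₀ N = (b₀ ^ 2 - S ^ 2) / 4 := by linarith
    have h0 : b₀ + S ≠ 0 := by positivity
    rw [hy]
    field_simp
    ring
  rw [e, abs_neg, abs_of_nonneg (by positivity)]
  -- The error is really O(1/N³); the additional factor N is discarded through N ≥ 1.
  have h3 : b₀ ^ 3 / 2 ≤ b₀ * S * (b₀ + S) * N := by
    calc b₀ ^ 3 / 2 = b₀ * (b₀ / 2) * b₀ * 1 := by ring
      _ ≤ _ := by
        gcongr
        linarith
  calc _ ≤ 16 * (16 * k₀ / (N : ℝ) ^ 2) / (b₀ ^ 3 / 2) := by gcongr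
    _ = _ := by field_simp; norm_num

end

end Platoon

/-! ### Choice of constants and assembly -/

theorem mainTheorem1 (k₀ b₀ : ℝ) (hk₀ : 0 < k₀) (hb₀ : 0 < b₀) :
    Platoon.Admissible Platoon.bangBang ∧
    ∃ (N₀ : ℕ) (ε₀ C : ℝ) (r : ℕ → (ℝ → ℝ) → ℝ), 0 < N₀ ∧ 0 < ε₀ ∧
      -- the least stable eigenvalue exists, is real and is unique
      (∀ N : ℕ, N₀ ≤ N → ∀ ε : ℝ, 0 ≤ ε → ε < ε₀ → ∀ κ : ℝ → ℝ, Platoon.Admissible κ →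
        Platoon.IsLeastStable (Platoon.eigenvalues k₀ b₀ N ε κ (fun x => -κ x))
          (Platoon.sOne k₀ b₀ N ε κ : ℂ)) ∧
      -- `r N κ` is its first-order coefficient in `ε`, with a uniform remainder
      (∀ N : ℕ, N₀ ≤ N → ∀ ε : ℝ, 0 ≤ ε → ε < ε₀ → ∀ κ : ℝ → ℝ, Platoon.Admissible κ →
        |Platoon.sOne k₀ b₀ N ε κ - Platoon.sOne k₀ b₀ N 0 κ - ε * r N κ| ≤ C * ε ^ 2) ∧
      -- the bang-bang profile is the unique minimizer of the first-order coefficient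
      (∀ N : ℕ, N₀ ≤ N → ∀ κ : ℝ → ℝ, Platoon.Admissible κ →
        r N Platoon.bangBang ≤ r N κ ∧
        (r N κ = r N Platoon.bangBang ↔ κ =ᵐ[Platoon.domMeasure] Platoon.bangBang)) ∧
      -- hence it minimizes the least stable eigenvalue up to second order, uniformly
      (∀ N : ℕ, N₀ ≤ N → ∀ ε : ℝ, 0 ≤ ε → ε < ε₀ → ∀ κ : ℝ → ℝ, Platoon.Admissible κ →
        Platoon.sOne k₀ b₀ N ε Platoon.bangBang ≤ Platoon.sOne k₀ b₀ N ε κ + C * ε ^ 2) ∧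
      -- the asymptotic formula for the bang-bang profile
      (∀ N : ℕ, N₀ ≤ N →
        |r N Platoon.bangBang - (-4 / (b₀ * N))| ≤ C / (N : ℝ) ^ 2) ∧
      (∀ N : ℕ, N₀ ≤ N → ∀ ε : ℝ, 0 ≤ ε → ε < ε₀ →
        |Platoon.sOne k₀ b₀ N ε Platoon.bangBang - (-4 * ε / (b₀ * N))|
          ≤ C * (ε ^ 2 + 1 / (N : ℝ) ^ 2)) ∧
      -- damping at least of order `1 / N` with mistuning, but of order `1 / N²` without
      (∀ N : ℕ, N₀ ≤ N → ∀ ε : ℝ, 0 ≤ ε → ε < ε₀ →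
        Platoon.sOne k₀ b₀ N ε Platoon.bangBang ≤ -4 * ε / (b₀ * N)) ∧
      (∀ N : ℕ, N₀ ≤ N → ∀ κ : ℝ → ℝ, Platoon.Admissible κ →
        |Platoon.sOne k₀ b₀ N 0 κ - (-(Real.pi ^ 2 * k₀) / (b₀ * (N : ℝ) ^ 2))|
          ≤ C / (N : ℝ) ^ 4) := by
  open Platoon in
  refine ⟨admissible_bangBang, ?_⟩
  set K := 8 + 36 / k₀ with hK
  have hKpos : 0 < K := by positivity
  obtain ⟨N₀, hN₀, hN₀b⟩ : ∃ N₀ : ℕ, 0 < N₀ ∧ ∀ N : ℕ, N₀ ≤ N → 256 * k₀ ≤ b₀ ^ 2 * N := by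
    refine ⟨⌈256 * k₀ / b₀ ^ 2⌉₊ + 1, Nat.succ_pos _, fun N hN => ?_⟩
    have h1 : 256 * k₀ / b₀ ^ 2 ≤ N :=
      (Nat.le_ceil _).trans (by exact_mod_cast (Nat.le_succ _).trans hN)
    rw [div_le_iff₀ (by positivity)] at h1
    linarith
  set ε₀ : ℝ := min 1 (b₀ ^ 2 / 8 / K) with hε₀
  have hε₀pos : 0 < ε₀ := by positivity
  have hεK : ∀ ε : ℝ, ε < ε₀ → K * ε ≤ b₀ ^ 2 / 8 := fun ε hε => by
    have := (hε.trans_le (min_le_right _ _)).le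
    rw [le_div_iff₀ hKpos] at this
    linarith
  have hε1 : ∀ ε : ℝ, ε < ε₀ → ε ≤ 1 := fun ε hε => (hε.trans_le (min_le_left _ _)).le
  have level : ∀ N : ℕ, N₀ ≤ N → ∀ ε : ℝ, 0 ≤ ε → ε < ε₀ → ∀ κ : ℝ → ℝ, Admissible κ → _ :=
    fun N hN ε hε hε' κ hκ =>
      exists_level hk₀ hb₀ (hN₀.trans_le hN) (hN₀b N hN) hε (hε1 ε hε') (hεK ε hε') hκ
  -- At ε = 0 the level estimate collapses to an equality, so the unperturbed eigenvalue does not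
  -- depend on the profile.
  have base : ∀ N : ℕ, N₀ ≤ N → ∀ κ : ℝ → ℝ, Admissible κ →
      sOne k₀ b₀ N 0 κ = stableRoot b₀ (baseLevel k₀ N) := by
    intro N hN κ hκ
    obtain ⟨y, -, h, -, -, -, hs⟩ := level N hN 0 le_rfl hε₀pos κ hκ
    rw [mul_zero] at h
    rw [hs, sub_eq_zero.1 (abs_nonpos_iff.1 h)]
  have hbase : ∀ N : ℕ, N₀ ≤ N → baseLevel k₀ N ≤ 3 * b₀ ^ 2 / 16 := fun N hN => by
    have := baseLevel_le_of_large hk₀ (hN₀.trans_le hN) (hN₀b N hN)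
    nlinarith [sq_nonneg b₀]
  set C₁ := 2 * (36 / k₀) / b₀ + 8 * K ^ 2 / b₀ ^ 3 with hC₁
  set C₂ := 512 * k₀ / b₀ ^ 3 with hC₂
  set C₃ := 1024 * k₀ ^ 2 / b₀ ^ 3 with hC₃
  set C₄ := 32 * k₀ / b₀ with hC₄
  have hC₁p : 0 ≤ C₁ := by positivity
  have hC₂p : 0 ≤ C₂ := by positivity
  have hC₃p : 0 ≤ C₃ := by positivity
  have hC₄p : 0 ≤ C₄ := by positivity
  have expand : ∀ N : ℕ, N₀ ≤ N → ∀ ε : ℝ, 0 ≤ ε → ε < ε₀ → ∀ κ : ℝ → ℝ, Admissible κ →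
      |sOne k₀ b₀ N ε κ - sOne k₀ b₀ N 0 κ - ε * firstOrder k₀ b₀ N κ| ≤ C₁ * ε ^ 2 := by
    intro N hN ε hε hε' κ hκ
    obtain ⟨y, h1, h2, h3, -, -, hs⟩ := level N hN ε hε hε' κ hκ
    have key := abs_stableRoot_sub_le hb₀ (half_le_sqrt h3) (half_le_sqrt (hbase N hN))
      (sqrt_sq_sub h3) (sqrt_sq_sub (hbase N hN)) h1 h2
    rw [hs, base N hN κ hκ]
    refine le_of_eq_of_le ?_ key
    rw [stableRoot, stableRoot, firstOrder]
    congr 1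
    ring
  have minim : ∀ N : ℕ, N₀ ≤ N → ∀ κ : ℝ → ℝ, Admissible κ →
      firstOrder k₀ b₀ N bangBang ≤ firstOrder k₀ b₀ N κ ∧
      (firstOrder k₀ b₀ N κ = firstOrder k₀ b₀ N bangBang ↔ κ =ᵐ[domMeasure] bangBang) := by
    intro N hN κ hκ
    obtain ⟨h1, h2⟩ := firstVariation_le_and_eq_iff hκ
    have hN0 : (0 : ℝ) < N := by exact_mod_cast hN₀.trans_le hN
    have hS : 0 < √(b₀ ^ 2 - 4 * baseLevel k₀ N) :=
      (half_pos hb₀).trans_le (half_le_sqrt (hbase N hN))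
    have hpi := Real.pi_pos
    refine ⟨?_, ?_⟩
    · unfold firstOrder
      gcongr
    · rw [← h2, firstOrder, firstOrder, neg_inj, div_left_inj' hS.ne',
        mul_right_inj' (by positivity)]
  -- One constant serves every estimate; C₁ is doubled because comparing two profiles uses two
  -- expansions.
  refine ⟨N₀, ε₀, 2 * C₁ + C₂ + C₃ + C₄, firstOrder k₀ b₀, hN₀, hε₀pos, ?_, ?_, minim, ?_, ?_,
    ?_, ?_, ?_⟩
  · intro N hN ε hε hε' κ hκ
    obtain ⟨y, -, -, -, -, h, -⟩ := level N hN ε hε hε' κ hκ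
    exact h
  · intro N hN ε hε hε' κ hκ
    exact (expand N hN ε hε hε' κ hκ).trans
      (mul_le_mul_of_nonneg_right (by linarith) (sq_nonneg ε))
  · intro N hN ε hε hε' κ hκ
    have h1 := (abs_le.1 (expand N hN ε hε hε' κ hκ)).1
    have h2 := (abs_le.1 (expand N hN ε hε hε' _ admissible_bangBang)).2
    rw [base N hN _ hκ] at h1
    rw [base N hN _ admissible_bangBang] at h2
    have h3 := mul_le_mul_of_nonneg_left (minim N hN κ hκ).1 hε
    have h4 : 2 * C₁ * ε ^ 2 ≤ (2 * C₁ + C₂ + C₃ + C₄) * ε ^ 2 :=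
      mul_le_mul_of_nonneg_right (by linarith) (sq_nonneg ε)
    linarith
  · intro N hN
    refine (abs_firstOrder_bangBang_sub_le hk₀ hb₀ (hN₀.trans_le hN) (hN₀b N hN)).trans ?_
    gcongr
    linarith
  · intro N hN ε hε hε'
    have hN0 : (0 : ℝ) < N := by exact_mod_cast hN₀.trans_le hN
    have h1 := expand N hN ε hε hε' _ admissible_bangBang
    have h2 : |sOne k₀ b₀ N 0 bangBang| ≤ C₄ / (N : ℝ) ^ 2 := by
      rw [base N hN _ admissible_bangBang]
      refine (abs_stableRoot_le hb₀ (baseLevel_nonneg hk₀) (hbase N hN)).trans ?_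
      calc _ ≤ 2 * (16 * k₀ / (N : ℝ) ^ 2) / b₀ := by
            gcongr
            exact baseLevel_le hk₀
        _ = _ := by rw [hC₄]; field_simp; norm_num
    have h3 : |ε * (firstOrder k₀ b₀ N bangBang - -4 / (b₀ * N))| ≤ C₂ / (N : ℝ) ^ 2 := by
      rw [abs_mul, abs_of_nonneg hε]
      calc _ ≤ 1 * (C₂ / (N : ℝ) ^ 2) :=
            mul_le_mul (hε1 ε hε')
              (abs_firstOrder_bangBang_sub_le hk₀ hb₀ (hN₀.trans_le hN) (hN₀b N hN))
              (abs_nonneg _) zero_le_one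
        _ = _ := one_mul _
    have e : sOne k₀ b₀ N ε bangBang - (-4 * ε / (b₀ * N))
        = (sOne k₀ b₀ N ε bangBang - sOne k₀ b₀ N 0 bangBang
            - ε * firstOrder k₀ b₀ N bangBang)
          + sOne k₀ b₀ N 0 bangBang + ε * (firstOrder k₀ b₀ N bangBang - -4 / (b₀ * N)) := by
      ring
    have h4 : C₁ * ε ^ 2 ≤ (2 * C₁ + C₂ + C₃ + C₄) * ε ^ 2 :=
      mul_le_mul_of_nonneg_right (by linarith) (sq_nonneg ε)
    have h5 : C₄ / (N : ℝ) ^ 2 + C₂ / (N : ℝ) ^ 2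
        ≤ (2 * C₁ + C₂ + C₃ + C₄) * (1 / (N : ℝ) ^ 2) := by
      rw [← add_div, mul_one_div]
      exact div_le_div_of_nonneg_right (by linarith) (by positivity)
    rw [e, mul_add]
    refine (abs_add_le _ _).trans ((add_le_add_left (abs_add_le _ _) _).trans ?_)
    linarith
  · intro N hN ε hε hε'
    have hN0 : (0 : ℝ) < N := by exact_mod_cast hN₀.trans_le hN
    obtain ⟨y, -, -, h3, h4, -, hs⟩ := level N hN ε hε hε' _ admissible_bangBang
    have hy := h4 rfl
    have hy0 : 0 ≤ y := le_trans (by positivity) hy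
    rw [hs]
    refine (stableRoot_le hb₀ hy0 h3).trans ?_
    have h5 : 4 * ε / N / b₀ ≤ y / b₀ := by gcongr
    have e : -4 * ε / (b₀ * N) = -(4 * ε / N / b₀) := by
      field_simp
    rw [e]
    linarith
  · intro N hN κ hκ
    have hN0 : (0 : ℝ) < N := by exact_mod_cast hN₀.trans_le hN
    have h1 := abs_stableRoot_add_le hb₀ (baseLevel_nonneg hk₀) (hbase N hN)
    have e : -(Real.pi ^ 2 * k₀) / (b₀ * (N : ℝ) ^ 2) = -(baseLevel k₀ N / b₀) := by
      unfold baseLevel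
      field_simp
    rw [base N hN κ hκ, e, sub_neg_eq_add]
    refine h1.trans ?_
    calc _ ≤ 4 * (16 * k₀ / (N : ℝ) ^ 2) ^ 2 / b₀ ^ 3 := by
          have := baseLevel_nonneg (N := N) hk₀
          have := baseLevel_le (N := N) hk₀
          gcongr
      _ = C₃ / (N : ℝ) ^ 4 := by
          rw [hC₃]
          field_simp
          norm_num
      _ ≤ _ := by
          gcongr
          linarith
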